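/- Let $\alpha,\beta\in\mathbb{C}$ and consider the system $$q'=p^2+zq+\alpha,\qquad p'=-q^2-zp-\beta. \tag{1}$$ For $z\in\mathbb{C}$ let $\mathcal{S}_z$ be the surface obtained from $\mathbb{CP}^2$, with charts $[1:q:p]=[u_1:1:u_2]=[v_1:v_2:1]$, by the following blow-ups, one sequence of three for each $\rho\in\mathbb{C}$ with $\rho^3=1$: blow up $(u_1,u_2)=(0,-\rho)$ and put $u_{2,1}=u_1$, $u_{2,2}=(u_2+\rho)/u_1$; then blow up $(u_{2,1},u_{2,2})=(0,\bar\rho z)$ and put $\hat u_{2,1}=u_{2,1}$, $\hat u_{2,2}=(u_{2,2}-\bar\rho z)/u_{2,1}$; then blow up $(\hat u_{2,1},\hat u_{2,2})=(0,\bar\rho\alpha-\rho\beta-1)$ and put $\tilde u_{2,1}=\hat u_{2,1}$, $\tilde u_{2,2}=(\hat u_{2,2}+1-\bar\rho\alpha+\rho\beta)/\hat u_{2,1}$. Let $L$ be the (strict transform of the) line at infinity, $L_1^{(\rho)},L_2^{(\rho)}$ the (strict transforms of the) first and second exceptional curves, $L_3^{(\rho)}$ the third exceptional curve, and $\mathcal{I}_z=\mathcal{S}_z\setminus\bigl(L\cup\bigcup_\rho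 (L_1^{(\rho)}\cup L_2^{(\rho)})\bigr)$ the space of initial conditions. In $\mathcal I_z$ one has, where $q\neq 0$, $\tilde u_{2,1}=1/q$ and $\tilde u_{2,2}=q\,(1-\bar\rho\alpha+\rho\beta-\bar\rho zq+\rho q^2+qp)$. **Theorem.** Let $(p,q)$ be a local analytic solution of (1) near $z_0\in\mathbb{C}$, and let $\Gamma$ be a rectifiable path from $z_0$ to $z_*\in\mathbb{C}$ such that $(p,q)$ can be continued analytically along $\Gamma$ up to, but not including, its endpoint $z_*$ (that is, it can be continued along $\Gamma$ without its endpoint, but not along all of $\Gamma$). Then there is a $\rho$ with $\rho^3=1$ such that the continued solution, written near the end of $\Gamma$ in the chart $(\tilde u_{2,1},\tilde u_{2,2})$ of $\mathcal{I}_z$ belonging to $\rho$, can be continued analytically to $z_*$. Its value at $z_*$ is a point $P\in L_3^{(\rho)}\cap\mathcal{I}_{z_*}$ with coordinates $(\tilde u_{2,1},\tilde u_{2,2})=(0,c)$ for some $c\in\mathbb{C}$, and $P$ is not covered by the chart $(p,q)$. In the variables $(p,q)$ the local analytic solution through $P$ is, in a punctured neighbourhood of $z_*$, a solution of (1) with a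 simple pole at $z_*$, which coincides with the continuation of the given solution near the end of $\Gamma$ and is given by convergent expansions $$q(z)=\frac{-\rho}{z-z_*}+\frac{\rho z_*}{2}+\Bigl(\rho\bigl(1+\tfrac{z_*^2}{4}\bigr)-\frac{\alpha}{3}+\frac23\bar\rho\beta\Bigr)(z-z_*)+h(z-z_*)^2+\sum_{n\ge3}c_n(z-z_*)^n,$$ $$p(z)=\frac{\bar\rho}{z-z_*}+\frac{\bar\rho z_*}{2}+\Bigl(\bar\rho\bigl(1-\tfrac{z_*^2}{4}\bigr)-\frac23\rho\alpha+\frac{\beta}{3}\Bigr)(z-z_*)+k(z-z_*)^2+\sum_{n\ge3}d_n(z-z_*)^n,$$ where $$h=\frac c2+\Bigl(-\frac\alpha2+\frac{7\rho}{8}+\frac{\beta\bar\rho}{2}\Bigr)z_*,\qquad k=\frac{c\rho}{2}-\frac{3\bar\rho z_*}{8}.$$ -/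

import Mathlib

open scoped LinearAlgebra.Projectivization Topology ComplexConjugate

noncomputable section

namespace CubicHamiltonian

/-! ### The Hamiltonian system and analytic continuation along a path -/

/-- `(p, q)` is a local analytic solution, near `z₀`, of
`q' = p² + z q + α`, `p' = -q² - z p - β`. -/
def IsLocalSolution (α β z₀ : ℂ) (p q : ℂ → ℂ) : Prop :=
  AnalyticAt ℂ p z₀ ∧ AnalyticAt ℂ q z₀ ∧
    ∀ᶠ z in 𝓝 z₀, HasDerivAt q (p z ^ 2 + z * q z + α) z ∧
      HasDerivAt p (-(q z) ^ 2 - z * p z - β) z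

/-- The germs at `γ t` (`t ∈ J`) of the functions `F t` form an analytic continuation along
the part of the path `γ` whose parameters lie in `J`: each germ is analytic, and for `s` near `t`
the germ number `s` is the one given by the function number `t`. -/
def ContinuesAlong {a b : ℂ} (γ : Path a b) (J : Set unitInterval)
    (F : unitInterval → ℂ → ℂ × ℂ) : Prop :=
  ∀ t ∈ J, AnalyticAt ℂ (F t) (γ t) ∧ ∀ᶠ s in 𝓝[J] t, F s =ᶠ[𝓝 (γ s)] F t

/-! ### Surfaces with coordinate charts, and the complex projective plane -/

/-- A set together with a family of coordinate charts with values in `ℂ²`. -/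
structure CoordSurface where
  /-- the set of points -/
  Carrier : Type
  /-- the names of the charts -/
  Index : Type
  /-- the charts -/
  chart : Index → PartialEquiv Carrier (ℂ × ℂ)

/-- The quotient of homogeneous coordinates `Xᵢ / Xⱼ`. -/
def ratio {n : ℕ} (x : ℙ ℂ (Fin n → ℂ)) (i j : Fin n) : ℂ := x.rep i / x.rep j

theorem ratio_mk {n : ℕ} (v : Fin n → ℂ) (hv : v ≠ 0) (i j : Fin n) :
    ratio (Projectivization.mk ℂ v hv) i j = v i / v j := by
  obtain ⟨a, ha⟩ := Projectivization.exists_smul_eq_mk_rep ℂ v hv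
  simp only [ratio, ← ha, Pi.smul_apply, Units.smul_def, smul_eq_mul]
  exact mul_div_mul_left _ _ a.ne_zero

theorem rep_mk_ne_zero {n : ℕ} (v : Fin n → ℂ) (hv : v ≠ 0) (j : Fin n) :
    (Projectivization.mk ℂ v hv).rep j ≠ 0 ↔ v j ≠ 0 := by
  obtain ⟨a, ha⟩ := Projectivization.exists_smul_eq_mk_rep ℂ v hv
  simp [← ha, Units.smul_def]

theorem mk_eq_of_ratio {n : ℕ} (x : ℙ ℂ (Fin n → ℂ)) (j : Fin n) (_ : x.rep j ≠ 0)
    (v : Fin n → ℂ) (hv : v ≠ 0) (h : ∀ i, v i = ratio x i j) :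
    Projectivization.mk ℂ v hv = x := by
  conv_rhs => rw [← Projectivization.mk_rep x]
  rw [Projectivization.mk_eq_mk_iff']
  refine ⟨(x.rep j)⁻¹, ?_⟩
  ext i
  simp [h, ratio, div_eq_inv_mul]

theorem vec3_ne {v : Fin 3 → ℂ} (j : Fin 3) (h : v j = 1) : v ≠ 0 := by
  rintro rfl
  simp at h

theorem vec2_ne {v : Fin 2 → ℂ} (j : Fin 2) (h : v j = 1) : v ≠ 0 := by
  rintro rfl
  simp at h

/-- The chart `(p, q)` of `ℂP²`, with `[1 : q : p]`. -/
def pqChart : PartialEquiv (ℙ ℂ (Fin 3 → ℂ)) (ℂ × ℂ) where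
  toFun x := (ratio x 2 0, ratio x 1 0)
  invFun y := Projectivization.mk ℂ ![1, y.2, y.1] (vec3_ne 0 rfl)
  source := {x | x.rep 0 ≠ 0}
  target := Set.univ
  map_source' _ _ := trivial
  map_target' y _ := by simp [rep_mk_ne_zero]
  left_inv' x hx := mk_eq_of_ratio x 0 hx _ _ fun i => by
    have hx : x.rep 0 ≠ 0 := hx
    fin_cases i <;> simp [ratio, hx]
  right_inv' y _ := by simp [ratio_mk]

/-- The chart `(u₁, u₂)` of `ℂP²`, with `[u₁ : 1 : u₂]`. -/
def uChart : PartialEquiv (ℙ ℂ (Fin 3 → ℂ)) (ℂ × ℂ) where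
  toFun x := (ratio x 0 1, ratio x 2 1)
  invFun y := Projectivization.mk ℂ ![y.1, 1, y.2] (vec3_ne 1 rfl)
  source := {x | x.rep 1 ≠ 0}
  target := Set.univ
  map_source' _ _ := trivial
  map_target' y _ := by simp [rep_mk_ne_zero]
  left_inv' x hx := mk_eq_of_ratio x 1 hx _ _ fun i => by
    have hx : x.rep 1 ≠ 0 := hx
    fin_cases i <;> simp [ratio, hx]
  right_inv' y _ := by simp [ratio_mk]

/-- The chart `(v₁, v₂)` of `ℂP²`, with `[v₁ : v₂ : 1]`. -/
def vChart : PartialEquiv (ℙ ℂ (Fin 3 → ℂ)) (ℂ × ℂ) where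
  toFun x := (ratio x 0 2, ratio x 1 2)
  invFun y := Projectivization.mk ℂ ![y.1, y.2, 1] (vec3_ne 2 rfl)
  source := {x | x.rep 2 ≠ 0}
  target := Set.univ
  map_source' _ _ := trivial
  map_target' y _ := by simp [rep_mk_ne_zero]
  left_inv' x hx := mk_eq_of_ratio x 2 hx _ _ fun i => by
    have hx : x.rep 2 ≠ 0 := hx
    fin_cases i <;> simp [ratio, hx]
  right_inv' y _ := by simp [ratio_mk]

/-- The names of the three standard charts of `ℂP²`. -/
inductive PlaneIndex
  | pq
  | u
  | v

/-- The complex projective plane with its three standard charts. -/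
def projectivePlane : CoordSurface where
  Carrier := ℙ ℂ (Fin 3 → ℂ)
  Index := PlaneIndex
  chart
    | .pq => pqChart
    | .u => uChart
    | .v => vChart

/-- The line at infinity of `ℂP²`. -/
def lineAtInfinity : Set projectivePlane.Carrier :=
  {x : ℙ ℂ (Fin 3 → ℂ) | x.rep 0 = 0}

/-! ### Blowing up a family of distinct points -/

/-- A family of distinct points of `X`, the point number `i` being given by its coordinates
`pos i` in the chart `idx i`. -/
structure Centres (X : CoordSurface) (I : Type) where
  /-- the chart in which the point is given -/
  idx : I → X.Index
  /-- the coordinates of the point -/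
  pos : I → ℂ × ℂ
  pos_mem : ∀ i, pos i ∈ (X.chart (idx i)).target
  injective : Function.Injective fun i => (X.chart (idx i)).symm (pos i)

theorem add_pair_zero (x : ℂ × ℂ) : x + (0, 0) = x := add_zero x

namespace Centres

variable {X : CoordSurface} {I : Type} (c : Centres X I)

/-- The point number `i` of the family. -/
def pt (i : I) : X.Carrier := (X.chart (c.idx i)).symm (c.pos i)

theorem pt_injective : Function.Injective c.pt := c.injective

/-- The points of the blow-up: every point `pt i` is replaced by the projective line of all
directions `[ζ₁ : ζ₂]` at that point, all other points are kept. -/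
abbrev BlowupCarrier : Type :=
  {x : X.Carrier // ∀ i, x ≠ c.pt i} ⊕ (I × ℙ ℂ (Fin 2 → ℂ))

open Classical in
/-- The point `x` seen in the blow-up, if it is not blown up; else the direction `d` at `pt i`. -/
def place (i : I) (x : X.Carrier) (d : ℙ ℂ (Fin 2 → ℂ)) : c.BlowupCarrier :=
  if h : ∀ j, x ≠ c.pt j then Sum.inl ⟨x, h⟩ else Sum.inr (i, d)

theorem place_of_ne (i : I) {x : X.Carrier} (d : ℙ ℂ (Fin 2 → ℂ)) (h : ∀ j, x ≠ c.pt j) :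
    c.place i x d = Sum.inl ⟨x, h⟩ := dif_pos h

theorem place_pt (i j : I) (d : ℙ ℂ (Fin 2 → ℂ)) :
    c.place i (c.pt j) d = Sum.inr (i, d) := dif_neg fun h => h j rfl

/-- The part of the chart `φ` that lies outside the blown-up points, as a chart of the blow-up. -/
def oldChart [Inhabited I] (φ : PartialEquiv X.Carrier (ℂ × ℂ)) :
    PartialEquiv c.BlowupCarrier (ℂ × ℂ) where
  toFun := Sum.elim (fun x => φ x.1) (fun _ => 0)
  invFun y := c.place default (φ.symm y) (Projectivization.mk ℂ ![1, 0] (vec2_ne 0 rfl))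
  source := {s | ∃ x, s = Sum.inl x ∧ x.1 ∈ φ.source}
  target := {y | y ∈ φ.target ∧ ∀ j, φ.symm y ≠ c.pt j}
  map_source' := by
    rintro _ ⟨⟨x, hx⟩, rfl, hs⟩
    exact ⟨φ.map_source hs, by simpa [φ.left_inv hs] using hx⟩
  map_target' := by
    rintro y ⟨hy, h⟩
    rw [c.place_of_ne _ _ h]
    exact ⟨_, rfl, φ.map_target hy⟩
  left_inv' := by
    rintro _ ⟨⟨x, hx⟩, rfl, hs⟩
    have e : φ.symm (φ x) = x := φ.left_inv hs
    simp only [Sum.elim_inl, e]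
    exact c.place_of_ne _ _ hx
  right_inv' := by
    rintro y ⟨hy, h⟩
    rw [c.place_of_ne _ _ h]
    exact φ.right_inv hy

/-- The point with coordinates `y` in the chart in which `pt i` is given. -/
def near (i : I) (y : ℂ × ℂ) : X.Carrier := (X.chart (c.idx i)).symm y

theorem near_ne {i : I} {y : ℂ × ℂ} (hy : y ∈ (X.chart (c.idx i)).target)
    (h : ∀ j, j ≠ i → c.near i y ≠ c.pt j) (hne : y ≠ c.pos i) (j : I) :
    c.near i y ≠ c.pt j := by
  by_cases hj : j = i
  · subst hj
    intro e
    exact hne ((X.chart (c.idx j)).symm.injOn hy (c.pos_mem j) e)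
  · exact h j hj

/-- The first chart of the blow-up over the point `P = pt i`: if `x₁, x₂` are the coordinates in
the chart in which `P` is given, then this is `((x₁ - P₁) / (x₂ - P₂), x₂ - P₂)`, extended to the
directions with `ζ₂ ≠ 0` by `(ζ₁ / ζ₂, 0)`. -/
def firstChart (i : I) : PartialEquiv c.BlowupCarrier (ℂ × ℂ) where
  toFun := Sum.elim
    (fun x => (((X.chart (c.idx i) x.1).1 - (c.pos i).1) /
        ((X.chart (c.idx i) x.1).2 - (c.pos i).2), (X.chart (c.idx i) x.1).2 - (c.pos i).2))
    (fun d => (ratio d.2 0 1, 0))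
  invFun y :=
    c.place i (c.near i (c.pos i + (y.1 * y.2, y.2))) (Projectivization.mk ℂ ![y.1, 1] (vec2_ne 1 rfl))
  source := {s | (∃ x, s = Sum.inl x ∧ x.1 ∈ (X.chart (c.idx i)).source ∧
      (X.chart (c.idx i) x.1).2 ≠ (c.pos i).2) ∨ ∃ d, s = Sum.inr (i, d) ∧ d.rep 1 ≠ 0}
  target := {y | c.pos i + (y.1 * y.2, y.2) ∈ (X.chart (c.idx i)).target ∧
      ∀ j, j ≠ i → c.near i (c.pos i + (y.1 * y.2, y.2)) ≠ c.pt j}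
  map_source' := by
    rintro _ (⟨⟨x, hx⟩, rfl, hs, hne⟩ | ⟨d, rfl, hd⟩)
    · have e : c.pos i + (((X.chart (c.idx i) x).1 - (c.pos i).1) /
          ((X.chart (c.idx i) x).2 - (c.pos i).2) * ((X.chart (c.idx i) x).2 - (c.pos i).2),
          (X.chart (c.idx i) x).2 - (c.pos i).2) = X.chart (c.idx i) x := by
        rw [div_mul_cancel₀ _ (sub_ne_zero.2 hne)]
        ext <;> simp
      simp only [Set.mem_ofPred_eq, Sum.elim_inl, e, near]
      refine ⟨(X.chart (c.idx i)).map_source hs, fun j _ => ?_⟩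
      rw [(X.chart (c.idx i)).left_inv hs]
      exact hx j
    · simp only [Set.mem_ofPred_eq, Sum.elim_inr, mul_zero, add_pair_zero]
      exact ⟨c.pos_mem i, fun j hj e => hj (c.pt_injective e).symm⟩
  map_target' := by
    rintro ⟨a, b⟩ ⟨hy, h⟩
    by_cases hb : b = 0
    · subst hb
      have e0 : c.near i (c.pos i + (a * 0, 0)) = c.pt i := by simp [near, pt, add_pair_zero]
      rw [e0, c.place_pt]
      exact Or.inr ⟨_, rfl, by simp [rep_mk_ne_zero]⟩
    · have h' := c.near_ne hy h (by simp [hb])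
      rw [c.place_of_ne _ _ h']
      refine Or.inl ⟨_, rfl, (X.chart (c.idx i)).map_target hy, ?_⟩
      simp only [near]
      rw [(X.chart (c.idx i)).right_inv hy]
      simp [hb]
  left_inv' := by
    rintro _ (⟨⟨x, hx⟩, rfl, hs, hne⟩ | ⟨d, rfl, hd⟩)
    · have e : c.pos i + (((X.chart (c.idx i) x).1 - (c.pos i).1) /
          ((X.chart (c.idx i) x).2 - (c.pos i).2) * ((X.chart (c.idx i) x).2 - (c.pos i).2),
          (X.chart (c.idx i) x).2 - (c.pos i).2) = X.chart (c.idx i) x := by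
        rw [div_mul_cancel₀ _ (sub_ne_zero.2 hne)]
        ext <;> simp
      have e' : (X.chart (c.idx i)).symm (X.chart (c.idx i) x) = x :=
        (X.chart (c.idx i)).left_inv hs
      simp only [Sum.elim_inl, e, near, e']
      exact c.place_of_ne _ _ hx
    · simp only [Sum.elim_inr]
      have e0 : c.near i (c.pos i + (ratio d 0 1 * 0, 0)) = c.pt i := by simp [near, pt, add_pair_zero]
      rw [e0, c.place_pt]
      congr 2
      exact mk_eq_of_ratio d 1 hd _ _ fun k => by fin_cases k <;> simp [ratio, hd]
  right_inv' := by
    rintro ⟨a, b⟩ ⟨hy, h⟩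
    by_cases hb : b = 0
    · subst hb
      have e0 : c.near i (c.pos i + (a * 0, 0)) = c.pt i := by simp [near, pt, add_pair_zero]
      rw [e0, c.place_pt]
      simp [ratio_mk]
    · have h' := c.near_ne hy h (by simp [hb])
      rw [c.place_of_ne _ _ h']
      simp only [Sum.elim_inl, near]
      rw [(X.chart (c.idx i)).right_inv hy]
      ext <;> simp [hb]

/-- The second chart of the blow-up over the point `P = pt i`: if `x₁, x₂` are the coordinates in
the chart in which `P` is given, then this is `(x₁ - P₁, (x₂ - P₂) / (x₁ - P₁))`, extended to the
directions with `ζ₁ ≠ 0` by `(0, ζ₂ / ζ₁)`. -/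
def secondChart (i : I) : PartialEquiv c.BlowupCarrier (ℂ × ℂ) where
  toFun := Sum.elim
    (fun x => ((X.chart (c.idx i) x.1).1 - (c.pos i).1,
      ((X.chart (c.idx i) x.1).2 - (c.pos i).2) / ((X.chart (c.idx i) x.1).1 - (c.pos i).1)))
    (fun d => (0, ratio d.2 1 0))
  invFun y :=
    c.place i (c.near i (c.pos i + (y.1, y.1 * y.2))) (Projectivization.mk ℂ ![1, y.2] (vec2_ne 0 rfl))
  source := {s | (∃ x, s = Sum.inl x ∧ x.1 ∈ (X.chart (c.idx i)).source ∧
      (X.chart (c.idx i) x.1).1 ≠ (c.pos i).1) ∨ ∃ d, s = Sum.inr (i, d) ∧ d.rep 0 ≠ 0}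
  target := {y | c.pos i + (y.1, y.1 * y.2) ∈ (X.chart (c.idx i)).target ∧
      ∀ j, j ≠ i → c.near i (c.pos i + (y.1, y.1 * y.2)) ≠ c.pt j}
  map_source' := by
    rintro _ (⟨⟨x, hx⟩, rfl, hs, hne⟩ | ⟨d, rfl, hd⟩)
    · have e : c.pos i + ((X.chart (c.idx i) x).1 - (c.pos i).1,
          ((X.chart (c.idx i) x).1 - (c.pos i).1) * (((X.chart (c.idx i) x).2 - (c.pos i).2) /
          ((X.chart (c.idx i) x).1 - (c.pos i).1))) = X.chart (c.idx i) x := by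
        rw [mul_div_cancel₀ _ (sub_ne_zero.2 hne)]
        ext <;> simp
      simp only [Set.mem_ofPred_eq, Sum.elim_inl, e, near]
      refine ⟨(X.chart (c.idx i)).map_source hs, fun j _ => ?_⟩
      rw [(X.chart (c.idx i)).left_inv hs]
      exact hx j
    · simp only [Set.mem_ofPred_eq, Sum.elim_inr, zero_mul, add_pair_zero]
      exact ⟨c.pos_mem i, fun j hj e => hj (c.pt_injective e).symm⟩
  map_target' := by
    rintro ⟨a, b⟩ ⟨hy, h⟩
    by_cases ha : a = 0
    · subst ha
      have e0 : c.near i (c.pos i + (0, 0 * b)) = c.pt i := by simp [near, pt, add_pair_zero]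
      rw [e0, c.place_pt]
      exact Or.inr ⟨_, rfl, by simp [rep_mk_ne_zero]⟩
    · have h' := c.near_ne hy h (by simp [ha])
      rw [c.place_of_ne _ _ h']
      refine Or.inl ⟨_, rfl, (X.chart (c.idx i)).map_target hy, ?_⟩
      simp only [near]
      rw [(X.chart (c.idx i)).right_inv hy]
      simp [ha]
  left_inv' := by
    rintro _ (⟨⟨x, hx⟩, rfl, hs, hne⟩ | ⟨d, rfl, hd⟩)
    · have e : c.pos i + ((X.chart (c.idx i) x).1 - (c.pos i).1,
          ((X.chart (c.idx i) x).1 - (c.pos i).1) * (((X.chart (c.idx i) x).2 - (c.pos i).2) /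
          ((X.chart (c.idx i) x).1 - (c.pos i).1))) = X.chart (c.idx i) x := by
        rw [mul_div_cancel₀ _ (sub_ne_zero.2 hne)]
        ext <;> simp
      have e' : (X.chart (c.idx i)).symm (X.chart (c.idx i) x) = x :=
        (X.chart (c.idx i)).left_inv hs
      simp only [Sum.elim_inl, e, near, e']
      exact c.place_of_ne _ _ hx
    · simp only [Sum.elim_inr]
      have e0 : c.near i (c.pos i + (0, 0 * ratio d 1 0)) = c.pt i := by simp [near, pt, add_pair_zero]
      rw [e0, c.place_pt]
      congr 2
      exact mk_eq_of_ratio d 0 hd _ _ fun k => by fin_cases k <;> simp [ratio, hd]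
  right_inv' := by
    rintro ⟨a, b⟩ ⟨hy, h⟩
    by_cases ha : a = 0
    · subst ha
      have e0 : c.near i (c.pos i + (0, 0 * b)) = c.pt i := by simp [near, pt, add_pair_zero]
      rw [e0, c.place_pt]
      simp [ratio_mk]
    · have h' := c.near_ne hy h (by simp [ha])
      rw [c.place_of_ne _ _ h']
      simp only [Sum.elim_inl, near]
      rw [(X.chart (c.idx i)).right_inv hy]
      ext <;> simp [ha]

end Centres

/-- The names of the charts of a blow-up: the old ones, and two new ones for each point. -/
inductive BlowupIndex (A I : Type)
  | old (a : A)
  | first (i : I)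
  | second (i : I)

/-- The blow-up of `X` at a family of distinct points, with all its charts. -/
def blowup {X : CoordSurface} {I : Type} [Inhabited I] (c : Centres X I) : CoordSurface where
  Carrier := c.BlowupCarrier
  Index := BlowupIndex X.Index I
  chart
    | .old a => c.oldChart (X.chart a)
    | .first i => c.firstChart i
    | .second i => c.secondChart i

section Curves

variable {X : CoordSurface} {I : Type} [Inhabited I] (c : Centres X I)

/-- The exceptional curve over the point number `i`. -/
def exceptional (i : I) : Set (blowup c).Carrier :=
  {s : c.BlowupCarrier | ∃ d, s = Sum.inr (i, d)}

/-- The strict transform of a (closed) curve `C`: the points of `C` that are not blown up and,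
over every blown-up point of `C`, the limiting directions of secants of `C` at that point. -/
def strictTransform (C : Set X.Carrier) : Set (blowup c).Carrier :=
  {s : c.BlowupCarrier | (∃ x, s = Sum.inl x ∧ x.1 ∈ C) ∨
    ∃ i d, s = Sum.inr (i, d) ∧ c.pt i ∈ C ∧
      (d.rep 0, d.rep 1) ∈ tangentConeAt ℂ
        (X.chart (c.idx i) '' (C ∩ (X.chart (c.idx i)).source)) (c.pos i)}

theorem second_target_zero (i : I) (b : ℂ) :
    ((0, b) : ℂ × ℂ) ∈ ((blowup c).chart (.second i)).target := by
  change _ ∈ (c.secondChart i).target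
  refine ⟨by simpa [add_pair_zero] using c.pos_mem i, fun j hj e => hj (c.pt_injective ?_).symm⟩
  simpa [Centres.near, Centres.pt, add_pair_zero] using e

theorem second_symm_zero (i : I) (b : ℂ) :
    ((blowup c).chart (.second i)).symm (0, b) =
      Sum.inr (i, Projectivization.mk ℂ ![1, b] (vec2_ne 0 rfl)) := by
  change (c.secondChart i).symm (0, b) = _
  change c.place i (c.near i (c.pos i + (0, 0 * b))) _ = _
  have e0 : c.near i (c.pos i + (0, 0 * b)) = c.pt i := by
    simp [Centres.near, Centres.pt, add_pair_zero]
  rw [e0, c.place_pt]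

end Curves

/-! ### The space of initial conditions -/

/-- The cube roots of unity. -/
abbrev CubeRoot : Type := {ρ : ℂ // ρ ^ 3 = 1}

instance : Inhabited CubeRoot := ⟨⟨1, by simp⟩⟩

/-- The three base points `(u₁, u₂) = (0, -ρ)` in `ℂP²`. -/
def centres₁ : Centres projectivePlane CubeRoot where
  idx _ := .u
  pos ρ := (0, -ρ)
  pos_mem _ := trivial
  injective ρ σ h := by
    have h' := uChart.symm.injOn (x₁ := (0, -(ρ : ℂ))) (x₂ := (0, -(σ : ℂ))) trivial trivial h
    simpa [Subtype.ext_iff] using h'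

/-- `ℂP²` blown up at the three base points; its new charts over `ρ` are `(u₁,₁, u₁,₂)` and
`(u₂,₁, u₂,₂)`. -/
def surface₁ : CoordSurface := blowup centres₁

/-- The base points `(u₂,₁, u₂,₂) = (0, conj ρ * z)` on the first exceptional curves. -/
def centres₂ (z : ℂ) : Centres surface₁ CubeRoot where
  idx ρ := .second ρ
  pos ρ := (0, conj (ρ : ℂ) * z)
  pos_mem ρ := second_target_zero centres₁ ρ _
  injective ρ σ h := by
    have h' := (second_symm_zero centres₁ ρ _).symm.trans (h.trans (second_symm_zero centres₁ σ _))
    exact (Prod.mk.inj (Sum.inr.inj h')).1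

/-- The second blow-up; its new charts over `ρ` are `(û₁,₁, û₁,₂)` and `(û₂,₁, û₂,₂)`. -/
def surface₂ (z : ℂ) : CoordSurface := blowup (centres₂ z)

/-- The base points `(û₂,₁, û₂,₂) = (0, conj ρ * α - ρ * β - 1)` on the second exceptional
curves. -/
def centres₃ (α β z : ℂ) : Centres (surface₂ z) CubeRoot where
  idx ρ := .second ρ
  pos ρ := (0, conj (ρ : ℂ) * α - ρ * β - 1)
  pos_mem ρ := second_target_zero (centres₂ z) ρ _
  injective ρ σ h := by
    have h' := (second_symm_zero (centres₂ z) ρ _).symm.trans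
      (h.trans (second_symm_zero (centres₂ z) σ _))
    exact (Prod.mk.inj (Sum.inr.inj h')).1

/-- The compact surface `𝒮`, at the time `z`: `ℂP²` blown up three times at each of the three base
points. -/
def compactSurface (α β z : ℂ) : CoordSurface := blowup (centres₃ α β z)

/-- The line at infinity in `𝒮`. -/
def lineL (α β z : ℂ) : Set (compactSurface α β z).Carrier :=
  strictTransform (centres₃ α β z)
    (strictTransform (centres₂ z) (strictTransform centres₁ lineAtInfinity))

/-- The curve in `𝒮` that comes from the first exceptional curve over `ρ`. -/
def curveL₁ (α β z : ℂ) (ρ : CubeRoot) : Set (compactSurface α β z).Carrier :=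
  strictTransform (centres₃ α β z) (strictTransform (centres₂ z) (exceptional centres₁ ρ))

/-- The curve in `𝒮` that comes from the second exceptional curve over `ρ`. -/
def curveL₂ (α β z : ℂ) (ρ : CubeRoot) : Set (compactSurface α β z).Carrier :=
  strictTransform (centres₃ α β z) (exceptional (centres₂ z) ρ)

/-- The third exceptional curve over `ρ`. -/
def curveL₃ (α β z : ℂ) (ρ : CubeRoot) : Set (compactSurface α β z).Carrier :=
  exceptional (centres₃ α β z) ρ

/-- The space of initial conditions at the time `z`, as a subset of `𝒮`. -/
def initialSpace (α β z : ℂ) : Set (compactSurface α β z).Carrier :=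
  (lineL α β z ∪ ⋃ ρ, (curveL₁ α β z ρ ∪ curveL₂ α β z ρ))ᶜ

/-- The charts of the space of initial conditions: those of `𝒮`, restricted to it. -/
def initialChart (α β z : ℂ) (i : (compactSurface α β z).Index) :
    PartialEquiv (compactSurface α β z).Carrier (ℂ × ℂ) :=
  ((compactSurface α β z).chart i).restr (initialSpace α β z)

/-- The original chart `(p, q)` of the space of initial conditions. -/
def originalChart (α β z : ℂ) : PartialEquiv (compactSurface α β z).Carrier (ℂ × ℂ) :=
  initialChart α β z (.old (.old (.old .pq)))

/-- The second chart `(ũ₂,₁, ũ₂,₂)` of the third blow-up over `ρ`, as a chart of the space of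
initial conditions. -/
def finalChart (α β z : ℂ) (ρ : CubeRoot) :
    PartialEquiv (compactSurface α β z).Carrier (ℂ × ℂ) :=
  initialChart α β z (.second ρ)

/-- The point of the space of initial conditions with coordinates `(p, q)`. -/
def point (α β z : ℂ) (y : ℂ × ℂ) : (compactSurface α β z).Carrier :=
  (originalChart α β z).symm y

/-! ### The simple poles -/

/-- Near `zs`, except at `zs` itself, `(p, q)` is given by the convergent Laurent expansions with
simple poles, residues `conj ρ` and `-ρ`, and parameters `h`, `k`. -/
def HasPoleExpansion (α β zs : ℂ) (ρ : CubeRoot) (h k : ℂ) (p q : ℂ → ℂ) : Prop :=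
  ∃ c d : ℕ → ℂ, ∀ᶠ z in 𝓝[≠] zs,
    HasSum (fun n : ℕ => c n * (z - zs) ^ (n + 3))
      (q z - (-ρ / (z - zs) + ρ * zs / 2
        + (ρ * (1 + zs ^ 2 / 4) - α / 3 + 2 / 3 * conj (ρ : ℂ) * β) * (z - zs)
        + h * (z - zs) ^ 2)) ∧
    HasSum (fun n : ℕ => d n * (z - zs) ^ (n + 3))
      (p z - (conj (ρ : ℂ) / (z - zs) + conj (ρ : ℂ) * zs / 2
        + (conj (ρ : ℂ) * (1 - zs ^ 2 / 4) - 2 / 3 * ρ * α + β / 3) * (z - zs)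
        + k * (z - zs) ^ 2))

end CubicHamiltonian

end

/-!
The theorem is a form of the Painlevé property. Its proof has three parts.

**A bounded energy.** At a simple pole the Hamiltonian `H` of the system grows like
`1 / (z - zs)`. The function `correctedEnergy`,
`W = H + (p² q̄ - q² p̄) / (1 + |p|² + |q|²)`, removes this growth. It is not holomorphic, but it is
smooth on all of `ℂ²`, and along every solution
`|dW| ≤ C (1 + |W|) |dz|` with no restriction on `(p, q)` (`exists_hasDerivAt_correctedEnergy`): in
both components of the derivative of `W`, the terms that `H` does not control cancel. Hence `W` is
bounded along a path of finite length (`exists_bound_correctedEnergy`), and no deformation of the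
path around zeros of `p` or `q` is needed.

**Large solutions lie in a final chart.** If `W` is bounded and `(p, q)` is large, then one of the
factors `p + ρ q` of `p³ + q³` is bounded, and for this `ρ` so are the coordinates of the first,
second and third blow-up, one after the other; the last of them is `W`, up to the factor `ρ²` and a
bounded error (`exists_chart_bound`). So near the end of the path the solution lies in a bounded
part of `ℂ²` or of one of the three final charts. In each of these the system is a polynomial vector
field (`systemField`, `chartField`), whose solutions exist on discs of a radius that is uniform on
bounded sets (`exists_uniform_radius`). Started close enough to the endpoint, such a solution
reaches beyond it, and by the identity theorem along the path it continues the given one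
(`continues_or_exists_chart_solution`). As the solution cannot be continued to `zs` in the variables
`(p, q)`, it is a solution `(u, v)` in a final chart with `u = 0` at `zs`.

**The expansion.** There `u' = -ρ²`, so `q = 1 / u` has a simple pole. The chart expresses `p` by
`q` and `v`; comparison of coefficients in the equation for `q'` then gives the first four
coefficients of `p` and `q` (`expansion_coefficients`). The resonance that would leave one of
them free is absent since `v = c` at `zs` is prescribed.
-/

noncomputable section

namespace CubicHamiltonian

/-! ### Holomorphic differential equations -/

section HolomorphicODE

variable {E : Type*} [NormedAddCommGroup E] [NormedSpace ℂ E]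

/-- Picard iteration for holomorphic functions on a disc: the primitives that define the iterates
exist because the disc is simply connected, and the iterates converge uniformly. -/
theorem exists_hasDerivAt_ball [CompleteSpace E] {F : ℂ × E → E} (hF : Differentiable ℂ F)
    {z₁ : ℂ} {y₁ : E} {δ a L M : ℝ} (ha : 0 ≤ a) (hL : 0 ≤ L)
    (hbd : ∀ z ∈ Metric.ball z₁ δ, ∀ y, ‖y - y₁‖ ≤ a → ‖F (z, y)‖ ≤ M)
    (hlip : ∀ z ∈ Metric.ball z₁ δ, ∀ y y', ‖y - y₁‖ ≤ a → ‖y' - y₁‖ ≤ a →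
      ‖F (z, y) - F (z, y')‖ ≤ L * ‖y - y'‖)
    (hδ : 0 < δ) (hM : M * δ ≤ a) (hLδ : L * δ ≤ 1 / 2) :
    ∃ y : ℂ → E, y z₁ = y₁ ∧ ∀ z ∈ Metric.ball z₁ δ, HasDerivAt y (F (z, y z)) z := by
  have hz₁ : z₁ ∈ Metric.ball z₁ δ := Metric.mem_ball_self hδ
  have hconv : Convex ℝ (Metric.ball z₁ δ) := convex_ball _ _
  let Good : (ℂ → E) → Prop := fun y => DifferentiableOn ℂ y (Metric.ball z₁ δ) ∧
    ∀ z ∈ Metric.ball z₁ δ, ‖y z - y₁‖ ≤ a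
  have hM0 : 0 ≤ M := (norm_nonneg _).trans (hbd z₁ hz₁ y₁ (by simpa using ha))
  have step : ∀ y : {y // Good y}, ∃ y' : {y // Good y}, y'.1 z₁ = y₁ ∧
      ∀ z ∈ Metric.ball z₁ δ, HasDerivAt y'.1 (F (z, y.1 z)) z := by
    rintro ⟨y, hyd, hya⟩
    have hd : DifferentiableOn ℂ (fun z => F (z, y z)) (Metric.ball z₁ δ) :=
      hF.comp_differentiableOn (differentiableOn_id.prodMk hyd)
    obtain ⟨g, hg1, hg⟩ := hd.isExactOn_ball.with_val_at z₁ y₁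
    refine ⟨⟨g, fun z hz => (hg z hz).differentiableAt.differentiableWithinAt, fun z hz => ?_⟩,
      hg1, hg⟩
    have := hconv.norm_image_sub_le_of_norm_hasDerivWithin_le
      (fun x hx => (hg x hx).hasDerivWithinAt) (fun x hx => hbd x hx _ (hya x hx)) hz₁ hz
    rw [hg1] at this
    refine this.trans (le_trans ?_ hM)
    have h2 : ‖z - z₁‖ < δ := by simpa [dist_eq_norm] using hz
    gcongr
  choose T hT1 hT using step
  have hconst : Good fun _ => y₁ := ⟨differentiableOn_const _, fun z _ => by simpa using ha⟩
  let Y : ℕ → {y // Good y} := fun n => T^[n] ⟨_, hconst⟩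
  have hY : ∀ n, Y (n + 1) = T (Y n) := fun n => Function.iterate_succ_apply' T n _
  have hstep : ∀ n, ∀ z ∈ Metric.ball z₁ δ,
      dist ((Y n).1 z) ((Y (n + 1)).1 z) ≤ a * (1 / 2) ^ n := by
    intro n
    induction n with
    | zero =>
      intro z hz
      have := (Y 1).2.2 z hz
      rw [dist_comm, dist_eq_norm]
      simpa [Y] using this
    | succ n ih =>
      intro z hz
      have hder : ∀ x ∈ Metric.ball z₁ δ, HasDerivWithinAt
          (fun x => (Y (n + 1 + 1)).1 x - (Y (n + 1)).1 x)
          (F (x, (Y (n + 1)).1 x) - F (x, (Y n).1 x)) (Metric.ball z₁ δ) x := by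
        intro x hx
        have h1 := hT (Y (n + 1)) x hx
        have h2 := hT (Y n) x hx
        rw [← hY] at h1 h2
        exact (h1.sub h2).hasDerivWithinAt
      have hle : ∀ x ∈ Metric.ball z₁ δ,
          ‖F (x, (Y (n + 1)).1 x) - F (x, (Y n).1 x)‖ ≤ L * (a * (1 / 2) ^ n) := by
        intro x hx
        refine (hlip x hx _ _ ((Y (n + 1)).2.2 x hx) ((Y n).2.2 x hx)).trans ?_
        have := ih x hx
        rw [dist_comm, dist_eq_norm] at this
        gcongr
      have := hconv.norm_image_sub_le_of_norm_hasDerivWithin_le hder hle hz₁ hz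
      have e1 : (Y (n + 1 + 1)).1 z₁ = y₁ := by rw [hY]; exact hT1 _
      have e2 : (Y (n + 1)).1 z₁ = y₁ := by rw [hY]; exact hT1 _
      rw [e1, e2, sub_self, sub_zero] at this
      rw [dist_comm, dist_eq_norm]
      refine this.trans ?_
      have h2 : ‖z - z₁‖ ≤ δ := by
        have : dist z z₁ < δ := hz
        rw [dist_eq_norm] at this
        exact this.le
      calc L * (a * (1 / 2) ^ n) * ‖z - z₁‖ ≤ L * (a * (1 / 2) ^ n) * δ := by gcongr
        _ = (L * δ) * (a * (1 / 2) ^ n) := by ring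
        _ ≤ 1 / 2 * (a * (1 / 2) ^ n) := by gcongr
        _ = a * (1 / 2) ^ (n + 1) := by ring
  have hlim : ∀ z, ∃ l, z ∈ Metric.ball z₁ δ →
      Filter.Tendsto (fun n => (Y n).1 z) Filter.atTop (𝓝 l) := by
    intro z
    by_cases hz : z ∈ Metric.ball z₁ δ
    · obtain ⟨l, hl⟩ := cauchySeq_tendsto_of_complete
        (cauchySeq_of_le_geometric (1 / 2 : ℝ) a (by norm_num) fun n => hstep n z hz)
      exact ⟨l, fun _ => hl⟩
    · exact ⟨0, fun h => absurd h hz⟩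
  choose y hy using hlim
  have hunif : TendstoUniformlyOn (fun n => (Y n).1) y Filter.atTop (Metric.ball z₁ δ) := by
    rw [Metric.tendstoUniformlyOn_iff]
    intro ε hε
    have h0 : Filter.Tendsto (fun n : ℕ => a * (1 / 2 : ℝ) ^ n / (1 - 1 / 2)) Filter.atTop
        (𝓝 0) := by
      have := ((tendsto_pow_atTop_nhds_zero_of_lt_one (r := (1 / 2 : ℝ)) (by norm_num)
        (by norm_num)).const_mul a).div_const (1 - 1 / 2)
      simpa using this
    filter_upwards [h0.eventually (gt_mem_nhds hε)] with n hn z hz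
    rw [dist_comm]
    exact (dist_le_of_le_geometric_of_tendsto (1 / 2 : ℝ) a (by norm_num)
      (fun n => hstep n z hz) (hy z hz) n).trans_lt hn
  have hloc := hunif.tendstoLocallyUniformlyOn
  have hdiffY : ∀ᶠ n in Filter.atTop, DifferentiableOn ℂ (Y n).1 (Metric.ball z₁ δ) :=
    Filter.Eventually.of_forall fun n => (Y n).2.1
  have hyd := hloc.differentiableOn hdiffY Metric.isOpen_ball
  have hder := hloc.deriv hdiffY Metric.isOpen_ball
  refine ⟨y, ?_, fun z hz => ?_⟩
  · refine tendsto_nhds_unique ((Filter.tendsto_add_atTop_iff_nat 1).2 (hy z₁ hz₁)) ?_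
    refine tendsto_const_nhds.congr fun n => ?_
    rw [hY]
    exact (hT1 _).symm
  · have h1 : Filter.Tendsto (fun n => deriv (Y (n + 1)).1 z) Filter.atTop (𝓝 (deriv y z)) :=
      (Filter.tendsto_add_atTop_iff_nat (f := fun n => deriv (Y n).1 z) 1).2
        (hder.tendsto_at hz)
    have h2 : Filter.Tendsto (fun n => deriv (Y (n + 1)).1 z) Filter.atTop (𝓝 (F (z, y z))) := by
      have : Filter.Tendsto (fun n => F (z, (Y n).1 z)) Filter.atTop (𝓝 (F (z, y z))) :=
        (hF.continuous.tendsto _).comp (tendsto_const_nhds.prodMk_nhds (hy z hz))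
      refine this.congr fun n => ?_
      rw [hY]
      exact (hT _ z hz).deriv.symm
    rw [← tendsto_nhds_unique h1 h2]
    exact (hyd.differentiableAt (Metric.isOpen_ball.mem_nhds hz)).hasDerivAt

/-- The radius of existence of the solutions can be chosen uniformly on bounded sets. -/
theorem exists_uniform_radius [ProperSpace E] {F : ℂ × E → E} (hF : ContDiff ℂ 1 F) (Z K : ℝ) :
    ∃ δ > 0, ∀ z₁ y₁, ‖z₁‖ ≤ Z → ‖y₁‖ ≤ K →
      ∃ y : ℂ → E, y z₁ = y₁ ∧ ∀ z ∈ Metric.ball z₁ δ, HasDerivAt y (F (z, y z)) z := by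
  set S : Set (ℂ × E) := Metric.closedBall 0 (Z + 1) ×ˢ Metric.closedBall 0 (K + 1) with hS
  have hSc : IsCompact S := (isCompact_closedBall _ _).prod (isCompact_closedBall _ _)
  have hSconv : Convex ℝ S := (convex_closedBall _ _).prod (convex_closedBall _ _)
  obtain ⟨M, hM⟩ := hSc.exists_bound_of_continuousOn hF.continuous.continuousOn
  obtain ⟨L, hL⟩ := hSc.exists_bound_of_continuousOn
    (hF.continuous_fderiv one_ne_zero).continuousOn
  have hlip : ∀ x ∈ S, ∀ y ∈ S, ‖F y - F x‖ ≤ |L| * ‖y - x‖ := fun x hx y hy =>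
    hSconv.norm_image_sub_le_of_norm_hasFDerivWithin_le (𝕜 := ℂ)
      (fun w _ => (hF.differentiable one_ne_zero w).hasFDerivAt.hasFDerivWithinAt)
      (fun w hw => (hL w hw).trans (le_abs_self L)) hx hy
  have p1 : (0 : ℝ) < |M| + 1 := by positivity
  have p2 : (0 : ℝ) < 2 * (|L| + 1) := by positivity
  refine ⟨min 1 (min (1 / (|M| + 1)) (1 / (2 * (|L| + 1)))), by positivity, ?_⟩
  intro z₁ y₁ hz₁ hy₁
  set δ := min 1 (min (1 / (|M| + 1)) (1 / (2 * (|L| + 1)))) with hδ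
  have d1 : δ ≤ 1 := min_le_left _ _
  have d2 : δ ≤ 1 / (|M| + 1) := (min_le_right _ _).trans (min_le_left _ _)
  have d3 : δ ≤ 1 / (2 * (|L| + 1)) := (min_le_right _ _).trans (min_le_right _ _)
  have hδ0 : 0 < δ := by positivity
  have hmem : ∀ z ∈ Metric.ball z₁ δ, ∀ y, ‖y - y₁‖ ≤ 1 → (z, y) ∈ S := by
    intro z hz y hy
    have hz' : ‖z - z₁‖ < δ := by simpa [dist_eq_norm] using hz
    refine ⟨?_, ?_⟩
    · rw [mem_closedBall_zero_iff]
      have := norm_add_le z₁ (z - z₁)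
      rw [add_sub_cancel] at this
      linarith
    · rw [mem_closedBall_zero_iff]
      have := norm_add_le y₁ (y - y₁)
      rw [add_sub_cancel] at this
      linarith
  refine exists_hasDerivAt_ball (a := 1) (L := |L|) (M := |M|) (hF.differentiable one_ne_zero)
    zero_le_one (abs_nonneg L) ?_ ?_ hδ0 ?_ ?_
  · intro z hz y hy
    exact (hM _ (hmem z hz y hy)).trans (le_abs_self M)
  · intro z hz y y' hy hy'
    have := hlip _ (hmem z hz y' hy') _ (hmem z hz y hy)
    simpa [Prod.norm_def] using this
  · rw [le_div_iff₀ p1] at d2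
    nlinarith [abs_nonneg M]
  · rw [le_div_iff₀ p2] at d3
    nlinarith [abs_nonneg L]

/-- Two solutions with the same initial value have the same germ. -/
theorem eventuallyEq_of_hasDerivAt {F : ℂ × E → E} (hF : ContDiff ℂ 1 F) {z₁ : ℂ} {y y' : ℂ → E}
    (hy : ∀ᶠ z in 𝓝 z₁, HasDerivAt y (F (z, y z)) z)
    (hy' : ∀ᶠ z in 𝓝 z₁, HasDerivAt y' (F (z, y' z)) z) (h : y z₁ = y' z₁) :
    y =ᶠ[𝓝 z₁] y' := by
  obtain ⟨K, t, ht, hK⟩ := (hF.contDiffAt (x := (z₁, y z₁))).exists_lipschitzOnWith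
  have c1 : Filter.Tendsto (fun z => (z, y z)) (𝓝 z₁) (𝓝 (z₁, y z₁)) :=
    (continuousAt_id.prodMk hy.self_of_nhds.continuousAt)
  have c2 : Filter.Tendsto (fun z => (z, y' z)) (𝓝 z₁) (𝓝 (z₁, y z₁)) := by
    rw [h]; exact (continuousAt_id.prodMk hy'.self_of_nhds.continuousAt)
  have c3 : ∀ᶠ z in 𝓝 z₁, ‖y z - y' z‖ < 1 := by
    have : Filter.Tendsto (fun z => ‖y z - y' z‖) (𝓝 z₁) (𝓝 ‖y z₁ - y' z₁‖) :=
      (hy.self_of_nhds.continuousAt.sub hy'.self_of_nhds.continuousAt).norm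
    rw [h, sub_self, norm_zero] at this
    exact this.eventually (gt_mem_nhds one_pos)
  obtain ⟨ε, hε, hall⟩ := Metric.eventually_nhds_iff_ball.1
    (hy.and (hy'.and ((c1.eventually ht).and ((c2.eventually ht).and c3))))
  set r := min ε (1 / (2 * ((K : ℝ) + 1))) with hr
  have hr0 : 0 < r := by positivity
  have hKr : (K : ℝ) * r ≤ 1 / 2 := by
    have : r ≤ 1 / (2 * ((K : ℝ) + 1)) := min_le_right _ _
    rw [le_div_iff₀ (by positivity)] at this
    nlinarith [K.2]
  have hsub : Metric.ball z₁ r ⊆ Metric.ball z₁ ε := Metric.ball_subset_ball (min_le_left _ _)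
  have key : ∀ n : ℕ, ∀ z ∈ Metric.ball z₁ r, ‖y z - y' z‖ ≤ (1 / 2) ^ n := by
    intro n
    induction n with
    | zero => intro z hz; simpa using (hall z (hsub hz)).2.2.2.2.le
    | succ n ih =>
      intro z hz
      have hder : ∀ x ∈ Metric.ball z₁ r, HasDerivWithinAt (fun x => y x - y' x)
          (F (x, y x) - F (x, y' x)) (Metric.ball z₁ r) x := fun x hx =>
        ((hall x (hsub hx)).1.sub (hall x (hsub hx)).2.1).hasDerivWithinAt
      have hle : ∀ x ∈ Metric.ball z₁ r, ‖F (x, y x) - F (x, y' x)‖ ≤ K * (1 / 2) ^ n := by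
        intro x hx
        have hx' := hall x (hsub hx)
        have := hK.norm_sub_le hx'.2.2.1 hx'.2.2.2.1
        refine this.trans ?_
        have h2 := ih x hx
        have h3 : ‖((x, y x) : ℂ × E) - (x, y' x)‖ = ‖y x - y' x‖ := by simp [Prod.norm_def]
        rw [h3]
        gcongr
      have := (convex_ball z₁ r).norm_image_sub_le_of_norm_hasDerivWithin_le hder hle
        (Metric.mem_ball_self hr0) hz
      rw [h, sub_self, sub_zero] at this
      have h2 : ‖z - z₁‖ ≤ r := by
        have : dist z z₁ < r := hz
        rw [dist_eq_norm] at this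
        exact this.le
      calc ‖y z - y' z‖ ≤ K * (1 / 2) ^ n * ‖z - z₁‖ := this
        _ ≤ K * (1 / 2) ^ n * r := by gcongr
        _ = (K * r) * (1 / 2) ^ n := by ring
        _ ≤ 1 / 2 * (1 / 2) ^ n := by gcongr
        _ = (1 / 2) ^ (n + 1) := by ring
  filter_upwards [Metric.ball_mem_nhds z₁ hr0] with z hz
  have h0 : ‖y z - y' z‖ ≤ 0 := ge_of_tendsto'
    (tendsto_pow_atTop_nhds_zero_of_lt_one (r := (1 / 2 : ℝ)) (by norm_num) (by norm_num))
    fun n => key n z hz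
  exact sub_eq_zero.1 (norm_le_zero_iff.1 h0)

end HolomorphicODE

/-! ### Germs along a path -/

section Germs

variable {E : Type*} [NormedAddCommGroup E] [NormedSpace ℂ E] [CompleteSpace E]

/-- The identity theorem along a path: a compatible family of germs that vanishes at one parameter
vanishes at all of them. -/
theorem eventuallyEq_zero_along {X : Type*} [TopologicalSpace X] {γ : X → ℂ} (hγ : Continuous γ)
    {J : Set X} (hJ : IsPreconnected J) {R : X → ℂ → E}
    (hR : ∀ t ∈ J, AnalyticAt ℂ (R t) (γ t) ∧ ∀ᶠ s in 𝓝[J] t, R s =ᶠ[𝓝 (γ s)] R t)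
    {t₀ : X} (ht₀ : t₀ ∈ J) (h₀ : R t₀ =ᶠ[𝓝 (γ t₀)] 0) {t : X} (ht : t ∈ J) :
    R t =ᶠ[𝓝 (γ t)] 0 := by
  refine (hJ.induction₂ (fun s t => R s =ᶠ[𝓝 (γ s)] 0 ↔ R t =ᶠ[𝓝 (γ t)] 0) ?_
    (fun _ _ _ _ _ _ h1 h2 => h1.trans h2) (fun _ _ _ _ h => h.symm) ht₀ ht).1 h₀
  intro x hx
  obtain ⟨r, hr, han⟩ := (hR x hx).1.exists_ball_analyticOnNhd
  have hball : ∀ᶠ s in 𝓝[J] x, γ s ∈ Metric.ball (γ x) r :=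
    nhdsWithin_le_nhds (hγ.continuousAt.eventually (Metric.ball_mem_nhds _ hr))
  filter_upwards [hball, (hR x hx).2] with s hs hsx
  have hpre : IsPreconnected (Metric.ball (γ x) r) := (convex_ball _ _).isPreconnected
  constructor
  · intro h
    have := han.eqOn_zero_of_preconnected_of_eventuallyEq_zero hpre (Metric.mem_ball_self hr) h
    exact hsx.trans (this.eventuallyEq_of_mem (Metric.isOpen_ball.mem_nhds hs))
  · intro h
    have := han.eqOn_zero_of_preconnected_of_eventuallyEq_zero hpre hs (hsx.symm.trans h)
    exact this.eventuallyEq_of_mem (Metric.ball_mem_nhds _ hr)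

end Germs

/-! ### The corrected energy -/

/-- The Hamiltonian of the system. -/
def hamiltonian (α β z p q : ℂ) : ℂ := (p ^ 3 + q ^ 3) / 3 + z * p * q + α * p + β * q

/-- The real number `1 + |p|² + |q|²`, written in terms of `p`, `q` and their conjugates. -/
def sizeSq (p q : ℂ) : ℂ := 1 + p * conj p + q * conj q

/-- The Hamiltonian with its growth `1 / (z - zs)` at a simple pole `zs` removed. The correction
is a weighted mean of `p ^ 2 / q` and `-q ^ 2 / p`, which agree to leading order where
`p ^ 3 + q ^ 3` is small; the weights `|q| ^ 2` and `|p| ^ 2`, and the summand `1` in the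
denominator, make it smooth everywhere. -/
def correctedEnergy (α β z p q : ℂ) : ℂ :=
  hamiltonian α β z p q + (p ^ 2 * conj q - q ^ 2 * conj p) / sizeSq p q

/-- The square root of `sizeSq`. -/
def size (p q : ℂ) : ℝ := √(1 + ‖p‖ ^ 2 + ‖q‖ ^ 2)

theorem size_sq (p q : ℂ) : size p q ^ 2 = 1 + ‖p‖ ^ 2 + ‖q‖ ^ 2 := Real.sq_sqrt (by positivity)

theorem sizeSq_eq (p q : ℂ) : sizeSq p q = ((size p q ^ 2 : ℝ) : ℂ) := by
  rw [size_sq, sizeSq, Complex.mul_conj, Complex.mul_conj, Complex.normSq_eq_norm_sq,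
    Complex.normSq_eq_norm_sq]
  push_cast
  ring

theorem one_le_size (p q : ℂ) : 1 ≤ size p q :=
  Real.one_le_sqrt.2 (by nlinarith [sq_nonneg ‖p‖, sq_nonneg ‖q‖])

theorem size_pos (p q : ℂ) : 0 < size p q := one_pos.trans_le (one_le_size p q)

theorem norm_left_le_size (p q : ℂ) : ‖p‖ ≤ size p q :=
  Real.le_sqrt_of_sq_le (by nlinarith [sq_nonneg ‖q‖])

theorem norm_right_le_size (p q : ℂ) : ‖q‖ ≤ size p q :=
  Real.le_sqrt_of_sq_le (by nlinarith [sq_nonneg ‖p‖])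

theorem sizeSq_ne_zero (p q : ℂ) : sizeSq p q ≠ 0 := by
  rw [sizeSq_eq]
  exact_mod_cast (pow_pos (size_pos p q) 2).ne'

theorem norm_sizeSq (p q : ℂ) : ‖sizeSq p q‖ = size p q ^ 2 := by
  rw [sizeSq_eq, Complex.norm_real, Real.norm_of_nonneg (by positivity)]

theorem norm_correction_le (p q : ℂ) :
    ‖(p ^ 2 * conj q - q ^ 2 * conj p) / sizeSq p q‖ ≤ 2 * size p q := by
  rw [norm_div, norm_sizeSq, div_le_iff₀ (pow_pos (size_pos p q) 2)]
  have h1 := norm_left_le_size p q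
  have h2 := norm_right_le_size p q
  calc ‖p ^ 2 * conj q - q ^ 2 * conj p‖ ≤ ‖p‖ ^ 2 * ‖q‖ + ‖q‖ ^ 2 * ‖p‖ := by
        refine (norm_sub_le _ _).trans (le_of_eq ?_)
        simp
    _ ≤ size p q ^ 2 * size p q + size p q ^ 2 * size p q := by gcongr
    _ = 2 * size p q * size p q ^ 2 := by ring

theorem norm_hamiltonian_le (α β z p q : ℂ) :
    ‖hamiltonian α β z p q‖ ≤ ‖correctedEnergy α β z p q‖ + 2 * size p q := by
  have h : hamiltonian α β z p q = correctedEnergy α β z p q -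
      (p ^ 2 * conj q - q ^ 2 * conj p) / sizeSq p q := by simp [correctedEnergy]
  rw [h]
  exact (norm_sub_le _ _).trans (by gcongr; exact norm_correction_le p q)

/-- The factor of `h` in the derivative of the corrected energy in the direction `h`, up to the
factor `sizeSq ^ 2`. Here `P`, `Q` are the conjugates of `p`, `q`. All terms of degree
five and more have a factor `hamiltonian` or `p ^ 3 + q ^ 3`. -/
theorem holomorphic_part_eq (α β z p q P Q : ℂ) :
    p * q * (1 + p * P + q * Q) ^ 2 +
      (2 * p * (-q ^ 2 - z * p - β) * Q - 2 * q * (p ^ 2 + z * q + α) * P) * (1 + p * P + q * Q) -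
      (p ^ 2 * Q - q ^ 2 * P) * ((-q ^ 2 - z * p - β) * P + (p ^ 2 + z * q + α) * Q) =
    -3 * hamiltonian α β z p q * (p * Q ^ 2 + q * P ^ 2) +
      3 * (α * p + β * q) * (p * Q ^ 2 + q * P ^ 2) - z * (p ^ 3 + q ^ 3) * (P * Q) -
      β * (p ^ 2 * P * Q + 2 * p * q * Q ^ 2 + q ^ 2 * P ^ 2) -
      α * (2 * p * q * P ^ 2 + q ^ 2 * P * Q + p ^ 2 * Q ^ 2) +
      p * q * (1 + 2 * (p * P + q * Q)) +
      2 * (p * (-q ^ 2 - z * p - β) * Q - q * (p ^ 2 + z * q + α) * P) := by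
  unfold hamiltonian
  ring

/-- The factor of the conjugate of `h` in the derivative of the corrected energy in the direction
`h`, up to the factor `sizeSq ^ 2`. Here `P`, `Q` are the conjugates of `p`, `q`, and `P'`, `Q'`
those of their derivatives. -/
theorem antiholomorphic_part_eq (p q P Q P' Q' : ℂ) :
    (p ^ 2 * Q' - q ^ 2 * P') * (1 + p * P + q * Q) -
      (p ^ 2 * Q - q ^ 2 * P) * (p * P' + q * Q') =
    (p ^ 3 + q ^ 3) * (P * Q' - Q * P') + (p ^ 2 * Q' - q ^ 2 * P') := by
  ring

section Bounds

variable {α β z p q : ℂ} {c : ℝ}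

theorem one_le_of_coeff_le (hc : 1 + ‖z‖ + ‖α‖ + ‖β‖ ≤ c) : 1 ≤ c := by
  linarith [norm_nonneg z, norm_nonneg α, norm_nonneg β]

theorem norm_deriv_q_le (hc : 1 + ‖z‖ + ‖α‖ + ‖β‖ ≤ c) :
    ‖p ^ 2 + z * q + α‖ ≤ c * size p q ^ 2 := by
  have h1 := norm_left_le_size p q
  have h2 := norm_right_le_size p q
  have h3 := one_le_size p q
  have h4 : size p q ≤ size p q ^ 2 := by nlinarith
  calc ‖p ^ 2 + z * q + α‖ ≤ ‖p‖ ^ 2 + ‖z‖ * ‖q‖ + ‖α‖ := by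
        refine (norm_add₃_le).trans (le_of_eq ?_); simp
    _ ≤ size p q ^ 2 + ‖z‖ * size p q ^ 2 + ‖α‖ * size p q ^ 2 := by
        gcongr
        · exact h2.trans h4
        · exact le_mul_of_one_le_right (norm_nonneg _) (h3.trans h4)
    _ ≤ c * size p q ^ 2 := by
        nlinarith [pow_pos (size_pos p q) 2, norm_nonneg β]

theorem norm_deriv_p_le (hc : 1 + ‖z‖ + ‖α‖ + ‖β‖ ≤ c) :
    ‖-q ^ 2 - z * p - β‖ ≤ c * size p q ^ 2 := by
  have h := norm_deriv_q_le (α := β) (β := α) (p := q) (q := p) (z := z) (c := c) (by linarith)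
  have e : size q p = size p q := by unfold size; congr 1; ring
  rw [e] at h
  rwa [show -q ^ 2 - z * p - β = -(q ^ 2 + z * p + β) by ring, norm_neg]

theorem norm_linear_le (hc : 1 + ‖z‖ + ‖α‖ + ‖β‖ ≤ c) :
    ‖α * p + β * q‖ ≤ c * size p q := by
  have h1 := norm_left_le_size p q
  have h2 := norm_right_le_size p q
  calc ‖α * p + β * q‖ ≤ ‖α‖ * ‖p‖ + ‖β‖ * ‖q‖ := by
        refine (norm_add_le _ _).trans (le_of_eq ?_); simp
    _ ≤ ‖α‖ * size p q + ‖β‖ * size p q := by gcongr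
    _ ≤ c * size p q := by nlinarith [size_pos p q, norm_nonneg z]

theorem norm_lower_le (hc : 1 + ‖z‖ + ‖α‖ + ‖β‖ ≤ c) :
    ‖z * p * q + α * p + β * q‖ ≤ c * size p q ^ 2 := by
  have h1 := norm_left_le_size p q
  have h2 := norm_right_le_size p q
  have h3 := one_le_size p q
  have h4 : size p q ≤ size p q ^ 2 := by nlinarith
  calc ‖z * p * q + α * p + β * q‖ ≤ ‖z‖ * (‖p‖ * ‖q‖) + ‖α‖ * ‖p‖ + ‖β‖ * ‖q‖ := by
        refine (norm_add₃_le).trans (le_of_eq ?_); simp [mul_assoc]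
    _ ≤ ‖z‖ * (size p q * size p q) + ‖α‖ * size p q ^ 2 + ‖β‖ * size p q ^ 2 := by
        gcongr
        · exact h1.trans h4
        · exact h2.trans h4
    _ ≤ c * size p q ^ 2 := by nlinarith [pow_pos (size_pos p q) 2]

theorem norm_cubes_le (hc : 1 + ‖z‖ + ‖α‖ + ‖β‖ ≤ c) :
    ‖p ^ 3 + q ^ 3‖ ≤ 3 * ‖hamiltonian α β z p q‖ + 3 * c * size p q ^ 2 := by
  have e : p ^ 3 + q ^ 3 = 3 * hamiltonian α β z p q - 3 * (z * p * q + α * p + β * q) := by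
    unfold hamiltonian; ring
  have h := norm_lower_le (p := p) (q := q) hc
  rw [e]
  refine (norm_sub_le _ _).trans ?_
  rw [norm_mul, norm_mul]
  simp only [Complex.norm_ofNat]
  linarith

theorem norm_hamiltonian_le_cube (hc : 1 + ‖z‖ + ‖α‖ + ‖β‖ ≤ c) :
    ‖hamiltonian α β z p q‖ ≤ 2 * c * size p q ^ 3 := by
  have h1 := norm_left_le_size p q
  have h2 := norm_right_le_size p q
  have h3 := one_le_size p q
  have h4 : size p q ^ 2 ≤ size p q ^ 3 := pow_le_pow_right₀ h3 (by norm_num)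
  have hc1 := one_le_of_coeff_le hc
  have h := norm_lower_le (p := p) (q := q) hc
  have e : hamiltonian α β z p q = (p ^ 3 + q ^ 3) / 3 + (z * p * q + α * p + β * q) := by
    unfold hamiltonian; ring
  have h5 : ‖(p ^ 3 + q ^ 3) / 3‖ ≤ size p q ^ 3 := by
    rw [norm_div, Complex.norm_ofNat, div_le_iff₀ (by norm_num)]
    calc ‖p ^ 3 + q ^ 3‖ ≤ ‖p‖ ^ 3 + ‖q‖ ^ 3 := by
          refine (norm_add_le _ _).trans (le_of_eq ?_); simp
      _ ≤ size p q ^ 3 + size p q ^ 3 := by gcongr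
      _ ≤ size p q ^ 3 * 3 := by nlinarith [pow_pos (size_pos p q) 3]
  rw [e]
  refine (norm_add_le _ _).trans ?_
  nlinarith [pow_pos (size_pos p q) 3, pow_pos (size_pos p q) 2]

/-- A product of the Hamiltonian and a cubic term is of order `size ^ 4`, relative to the corrected
energy, because the correction is only of order `size`. -/
theorem size_cube_mul_norm_hamiltonian_le (α β z p q : ℂ) :
    size p q ^ 3 * ‖hamiltonian α β z p q‖ ≤
      2 * size p q ^ 4 * (1 + ‖correctedEnergy α β z p q‖) := by
  have h := norm_hamiltonian_le α β z p q
  have h3 := one_le_size p q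
  have h0 := norm_nonneg (correctedEnergy α β z p q)
  calc size p q ^ 3 * ‖hamiltonian α β z p q‖
      ≤ size p q ^ 3 * (‖correctedEnergy α β z p q‖ * size p q + 2 * size p q) := by
        gcongr
        exact h.trans (by gcongr; exact le_mul_of_one_le_right h0 h3)
    _ = size p q ^ 4 * (2 + ‖correctedEnergy α β z p q‖) := by ring
    _ ≤ size p q ^ 4 * (2 * (1 + ‖correctedEnergy α β z p q‖)) := by gcongr; linarith
    _ = _ := by ring

theorem norm_antiholomorphic_part_le (hc : 1 + ‖z‖ + ‖α‖ + ‖β‖ ≤ c) :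
    ‖(p ^ 3 + q ^ 3) * (conj p * conj (p ^ 2 + z * q + α) - conj q * conj (-q ^ 2 - z * p - β)) +
      (p ^ 2 * conj (p ^ 2 + z * q + α) - q ^ 2 * conj (-q ^ 2 - z * p - β))‖ ≤
    200 * c ^ 2 * size p q ^ 4 * (1 + ‖correctedEnergy α β z p q‖) := by
  have hc1 := one_le_of_coeff_le hc
  have h1 := norm_left_le_size p q
  have h2 := norm_right_le_size p q
  have h3 := one_le_size p q
  have hE := norm_cubes_le (p := p) (q := q) hc
  have hH := norm_hamiltonian_le_cube (p := p) (q := q) hc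
  have hHW := size_cube_mul_norm_hamiltonian_le α β z p q
  have hW0 := norm_nonneg (correctedEnergy α β z p q)
  have hH0 := norm_nonneg (hamiltonian α β z p q)
  have hl := norm_lower_le (p := p) (q := q) hc
  have hz : ‖z * p * q‖ ≤ c * size p q ^ 2 := by
    rw [norm_mul, norm_mul]
    calc ‖z‖ * ‖p‖ * ‖q‖ ≤ c * size p q * size p q := by
          gcongr; linarith [norm_nonneg z, norm_nonneg α, norm_nonneg β]
      _ = _ := by ring
  have e1 : conj p * conj (p ^ 2 + z * q + α) - conj q * conj (-q ^ 2 - z * p - β) =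
      conj (p ^ 3 + q ^ 3 + (z * p * q + (z * p * q + α * p + β * q))) := by
    simp only [map_add, map_mul, map_pow, map_sub, map_neg]; ring
  have n1 : ‖conj p * conj (p ^ 2 + z * q + α) - conj q * conj (-q ^ 2 - z * p - β)‖ ≤
      ‖p ^ 3 + q ^ 3‖ + 2 * c * size p q ^ 2 := by
    rw [e1, Complex.norm_conj]
    refine (norm_add_le _ _).trans ?_
    have := norm_add_le (z * p * q) (z * p * q + α * p + β * q)
    linarith
  have n2 : ‖p ^ 2 * conj (p ^ 2 + z * q + α) - q ^ 2 * conj (-q ^ 2 - z * p - β)‖ ≤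
      2 * c * size p q ^ 4 := by
    have a1 := norm_deriv_q_le (p := p) (q := q) hc
    have a2 := norm_deriv_p_le (p := p) (q := q) hc
    calc _ ≤ ‖p‖ ^ 2 * ‖p ^ 2 + z * q + α‖ + ‖q‖ ^ 2 * ‖-q ^ 2 - z * p - β‖ := by
          refine (norm_sub_le _ _).trans (le_of_eq ?_)
          rw [norm_mul, norm_mul, Complex.norm_conj, Complex.norm_conj, norm_pow, norm_pow]
      _ ≤ size p q ^ 2 * (c * size p q ^ 2) + size p q ^ 2 * (c * size p q ^ 2) := by gcongr
      _ = _ := by ring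
  set r := size p q with hr
  set H := ‖hamiltonian α β z p q‖
  set W := ‖correctedEnergy α β z p q‖
  have r4 : 0 < r ^ 4 := by positivity
  have hHr : r ^ 2 * H ≤ r ^ 3 * H := by gcongr; norm_num
  have hHH : H ^ 2 ≤ 2 * c * (r ^ 3 * H) := by nlinarith
  refine (norm_add_le _ _).trans ?_
  rw [norm_mul]
  calc _ ≤ (3 * H + 3 * c * r ^ 2) * ((3 * H + 3 * c * r ^ 2) + 2 * c * r ^ 2) +
        2 * c * r ^ 4 := by
        gcongr
        exact n1.trans (by gcongr)
    _ = 9 * H ^ 2 + 24 * c * (r ^ 2 * H) + (15 * c ^ 2 + 2 * c) * r ^ 4 := by ring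
    _ ≤ 9 * (2 * c * (2 * r ^ 4 * (1 + W))) + 24 * c * (2 * r ^ 4 * (1 + W)) +
        (15 * c ^ 2 + 2 * c) * (r ^ 4 * (1 + W)) := by
        have k1 : 2 * c * (r ^ 3 * H) ≤ 2 * c * (2 * r ^ 4 * (1 + W)) :=
          mul_le_mul_of_nonneg_left hHW (by linarith)
        have k2 := mul_le_mul_of_nonneg_left (hHr.trans hHW) (by linarith : 0 ≤ 24 * c)
        have k3 := mul_le_mul_of_nonneg_left
          (le_mul_of_one_le_right r4.le (by linarith : 1 ≤ 1 + W))
          (by positivity : 0 ≤ 15 * c ^ 2 + 2 * c)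
        linarith
    _ = (86 * c + 15 * c ^ 2) * (r ^ 4 * (1 + W)) := by ring
    _ ≤ (200 * c ^ 2) * (r ^ 4 * (1 + W)) := by gcongr; nlinarith
    _ = _ := by ring

theorem norm_holomorphic_part_le (hc : 1 + ‖z‖ + ‖α‖ + ‖β‖ ≤ c) :
    ‖-3 * hamiltonian α β z p q * (p * conj q ^ 2 + q * conj p ^ 2) +
      3 * (α * p + β * q) * (p * conj q ^ 2 + q * conj p ^ 2) -
      z * (p ^ 3 + q ^ 3) * (conj p * conj q) -
      β * (p ^ 2 * conj p * conj q + 2 * p * q * conj q ^ 2 + q ^ 2 * conj p ^ 2) -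
      α * (2 * p * q * conj p ^ 2 + q ^ 2 * conj p * conj q + p ^ 2 * conj q ^ 2) +
      p * q * (1 + 2 * (p * conj p + q * conj q)) +
      2 * (p * (-q ^ 2 - z * p - β) * conj q - q * (p ^ 2 + z * q + α) * conj p)‖ ≤
    200 * c ^ 2 * size p q ^ 4 * (1 + ‖correctedEnergy α β z p q‖) := by
  have hc1 := one_le_of_coeff_le hc
  have h1 := norm_left_le_size p q
  have h2 := norm_right_le_size p q
  have h3 := one_le_size p q
  have hE := norm_cubes_le (p := p) (q := q) hc
  have hHW := size_cube_mul_norm_hamiltonian_le α β z p q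
  have hW0 := norm_nonneg (correctedEnergy α β z p q)
  have hH0 := norm_nonneg (hamiltonian α β z p q)
  have hl := norm_linear_le (p := p) (q := q) hc
  have a1 := norm_deriv_q_le (p := p) (q := q) hc
  have a2 := norm_deriv_p_le (p := p) (q := q) hc
  have hX : ‖p * conj q ^ 2 + q * conj p ^ 2‖ ≤ 2 * size p q ^ 3 := by
    calc _ ≤ ‖p‖ * ‖q‖ ^ 2 + ‖q‖ * ‖p‖ ^ 2 := by
          refine (norm_add_le _ _).trans (le_of_eq ?_); simp
      _ ≤ size p q * size p q ^ 2 + size p q * size p q ^ 2 := by gcongr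
      _ = _ := by ring
  have hPQ : ‖conj p * conj q‖ ≤ size p q ^ 2 := by
    rw [norm_mul, Complex.norm_conj, Complex.norm_conj, pow_two]
    gcongr
  have hβ : ‖p ^ 2 * conj p * conj q + 2 * p * q * conj q ^ 2 + q ^ 2 * conj p ^ 2‖ ≤
      4 * size p q ^ 4 := by
    calc _ ≤ ‖p‖ ^ 2 * ‖p‖ * ‖q‖ + 2 * ‖p‖ * ‖q‖ * ‖q‖ ^ 2 + ‖q‖ ^ 2 * ‖p‖ ^ 2 := by
          refine (norm_add₃_le).trans (le_of_eq ?_); simp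
      _ ≤ size p q ^ 2 * size p q * size p q + 2 * size p q * size p q * size p q ^ 2 +
          size p q ^ 2 * size p q ^ 2 := by gcongr
      _ = _ := by ring
  have hα : ‖2 * p * q * conj p ^ 2 + q ^ 2 * conj p * conj q + p ^ 2 * conj q ^ 2‖ ≤
      4 * size p q ^ 4 := by
    calc _ ≤ 2 * ‖p‖ * ‖q‖ * ‖p‖ ^ 2 + ‖q‖ ^ 2 * ‖p‖ * ‖q‖ + ‖p‖ ^ 2 * ‖q‖ ^ 2 := by
          refine (norm_add₃_le).trans (le_of_eq ?_); simp
      _ ≤ 2 * size p q * size p q * size p q ^ 2 + size p q ^ 2 * size p q * size p q +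
          size p q ^ 2 * size p q ^ 2 := by gcongr
      _ = _ := by ring
  have hpq : ‖p * q * (1 + 2 * (p * conj p + q * conj q))‖ ≤ 5 * size p q ^ 4 := by
    have : ‖1 + 2 * (p * conj p + q * conj q)‖ ≤ 5 * size p q ^ 2 := by
      calc _ ≤ 1 + 2 * (‖p‖ * ‖p‖ + ‖q‖ * ‖q‖) := by
            refine (norm_add_le _ _).trans ?_
            rw [norm_one, norm_mul, Complex.norm_ofNat]
            gcongr
            refine (norm_add_le _ _).trans (le_of_eq ?_); simp
        _ ≤ size p q ^ 2 + 2 * (size p q * size p q + size p q * size p q) := by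
            gcongr
            exact one_le_pow₀ h3
        _ = _ := by ring
    rw [norm_mul, norm_mul]
    calc _ ≤ size p q * size p q * (5 * size p q ^ 2) := by gcongr
      _ = _ := by ring
  have hd : ‖2 * (p * (-q ^ 2 - z * p - β) * conj q - q * (p ^ 2 + z * q + α) * conj p)‖ ≤
      4 * c * size p q ^ 4 := by
    rw [norm_mul, Complex.norm_ofNat]
    calc _ ≤ 2 * (‖p‖ * ‖-q ^ 2 - z * p - β‖ * ‖q‖ + ‖q‖ * ‖p ^ 2 + z * q + α‖ * ‖p‖) := by
          gcongr
          refine (norm_sub_le _ _).trans (le_of_eq ?_)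
          simp only [norm_mul, Complex.norm_conj]
      _ ≤ 2 * (size p q * (c * size p q ^ 2) * size p q +
            size p q * (c * size p q ^ 2) * size p q) := by gcongr
      _ = _ := by ring
  set r := size p q with hr
  set H := ‖hamiltonian α β z p q‖ with hHdef
  set W := ‖correctedEnergy α β z p q‖
  have hzc : ‖z‖ ≤ c := by linarith [norm_nonneg z, norm_nonneg α, norm_nonneg β]
  have hαc : ‖α‖ ≤ c := by linarith [norm_nonneg z, norm_nonneg α, norm_nonneg β]
  have hβc : ‖β‖ ≤ c := by linarith [norm_nonneg z, norm_nonneg α, norm_nonneg β]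
  have t1 : ‖-3 * hamiltonian α β z p q * (p * conj q ^ 2 + q * conj p ^ 2)‖ ≤
      3 * H * (2 * r ^ 3) := by
    rw [norm_mul, norm_mul, norm_neg, Complex.norm_ofNat]; gcongr
  have t2 : ‖3 * (α * p + β * q) * (p * conj q ^ 2 + q * conj p ^ 2)‖ ≤
      3 * (c * r) * (2 * r ^ 3) := by
    rw [norm_mul, norm_mul, Complex.norm_ofNat]; gcongr
  have t3 : ‖z * (p ^ 3 + q ^ 3) * (conj p * conj q)‖ ≤ c * (3 * H + 3 * c * r ^ 2) * r ^ 2 := by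
    rw [norm_mul, norm_mul]; gcongr
  have t4 : ‖β * (p ^ 2 * conj p * conj q + 2 * p * q * conj q ^ 2 + q ^ 2 * conj p ^ 2)‖ ≤
      c * (4 * r ^ 4) := by rw [norm_mul]; gcongr
  have t5 : ‖α * (2 * p * q * conj p ^ 2 + q ^ 2 * conj p * conj q + p ^ 2 * conj q ^ 2)‖ ≤
      c * (4 * r ^ 4) := by rw [norm_mul]; gcongr
  have r4 : 0 < r ^ 4 := by positivity
  have hHr : r ^ 2 * H ≤ r ^ 3 * H := by gcongr; norm_num
  refine (norm_add_le_of_le (norm_add_le_of_le (norm_sub_le_of_le (norm_sub_le_of_le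
    (norm_sub_le_of_le (norm_add_le_of_le t1 t2) t3) t4) t5) hpq) hd).trans ?_
  calc _ = 6 * (r ^ 3 * H) + 3 * c * (r ^ 2 * H) + (18 * c + 3 * c ^ 2 + 5) * r ^ 4 := by ring
    _ ≤ 6 * (2 * r ^ 4 * (1 + W)) + 3 * c * (2 * r ^ 4 * (1 + W)) +
        (18 * c + 3 * c ^ 2 + 5) * (r ^ 4 * (1 + W)) := by
        have k2 := mul_le_mul_of_nonneg_left (hHr.trans hHW) (by linarith : 0 ≤ 3 * c)
        have k3 := mul_le_mul_of_nonneg_left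
          (le_mul_of_one_le_right r4.le (by linarith : 1 ≤ 1 + W))
          (by positivity : 0 ≤ 18 * c + 3 * c ^ 2 + 5)
        linarith
    _ = (17 + 24 * c + 3 * c ^ 2) * (r ^ 4 * (1 + W)) := by ring
    _ ≤ (200 * c ^ 2) * (r ^ 4 * (1 + W)) := by gcongr; nlinarith
    _ = _ := by ring

end Bounds

/-- Along a solution, in any direction `h`, the corrected energy has a derivative of size
`O(1 + |W|) |h|`; there is no assumption on the size of `p` and `q`. -/
theorem exists_hasDerivAt_correctedEnergy {α β : ℂ} {c : ℝ} {p q : ℂ → ℂ} {z h : ℂ} {x : ℝ}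
    (hc : 1 + ‖z + x * h‖ + ‖α‖ + ‖β‖ ≤ c)
    (hq : HasDerivAt q (p (z + x * h) ^ 2 + (z + x * h) * q (z + x * h) + α) (z + x * h))
    (hp : HasDerivAt p (-(q (z + x * h)) ^ 2 - (z + x * h) * p (z + x * h) - β) (z + x * h)) :
    ∃ D : ℂ, HasDerivAt (fun s : ℝ => correctedEnergy α β (z + s * h) (p (z + s * h))
        (q (z + s * h))) D x ∧
      ‖D‖ ≤ 400 * c ^ 2 * ‖h‖ *
        (1 + ‖correctedEnergy α β (z + x * h) (p (z + x * h)) (q (z + x * h))‖) := by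
  set w := z + x * h with hw
  have hline : HasDerivAt (fun s : ℝ => z + s * h) h x := by
    have h1 : HasDerivAt (fun s : ℂ => z + s * h) h (x : ℂ) := by
      simpa using ((hasDerivAt_id (x : ℂ)).mul_const h).const_add z
    exact h1.comp_ofReal
  have hP : HasDerivAt (fun s : ℝ => p (z + s * h)) ((-(q w) ^ 2 - w * p w - β) * h) x :=
    HasDerivAt.comp x (h₂ := p) hp hline
  have hQ : HasDerivAt (fun s : ℝ => q (z + s * h)) ((p w ^ 2 + w * q w + α) * h) x :=
    HasDerivAt.comp x (h₂ := q) hq hline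
  have hPc : HasDerivAt (fun s : ℝ => conj (p (z + s * h)))
      (conj ((-(q w) ^ 2 - w * p w - β) * h)) x := hP.star
  have hQc : HasDerivAt (fun s : ℝ => conj (q (z + s * h)))
      (conj ((p w ^ 2 + w * q w + α) * h)) x := hQ.star
  have hN : sizeSq (p w) (q w) ≠ 0 := sizeSq_ne_zero _ _
  have hD := ((((((hP.pow 3).add (hQ.pow 3)).div_const 3).add ((hline.mul hP).mul hQ)).add
    (hP.const_mul α)).add (hQ.const_mul β)).add
    ((((hP.pow 2).mul hQc).sub ((hQ.pow 2).mul hPc)).div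
      (((hP.mul hPc).const_add 1).add (hQ.mul hQc)) (by
        simpa [sizeSq, ← hw] using hN))
  refine ⟨_, hD, ?_⟩
  have hA := norm_holomorphic_part_le (p := p w) (q := q w) hc
  have hB := norm_antiholomorphic_part_le (p := p w) (q := q w) hc
  rw [← holomorphic_part_eq] at hA
  rw [← antiholomorphic_part_eq] at hB
  simp only [Pi.pow_apply, Pi.mul_apply, Pi.add_apply, Pi.sub_apply, ← hw]
  have hN' : 1 + p w * conj (p w) + q w * conj (q w) = sizeSq (p w) (q w) := rfl
  rw [hN'] at hA hB ⊢
  generalize hAe : p w * q w * sizeSq (p w) (q w) ^ 2 + _ - _ = A at hA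
  generalize hBe : (p w ^ 2 * conj (p w ^ 2 + w * q w + α) -
    q w ^ 2 * conj (-q w ^ 2 - w * p w - β)) * sizeSq (p w) (q w) - _ = B at hB
  have key : ∀ D : ℂ, D * sizeSq (p w) (q w) ^ 2 = h * A + conj h * B →
      ‖D‖ ≤ 400 * c ^ 2 * ‖h‖ * (1 + ‖correctedEnergy α β w (p w) (q w)‖) := by
    intro D hD
    have r4 : 0 < size (p w) (q w) ^ 4 := pow_pos (size_pos _ _) 4
    have h1 : ‖D‖ * size (p w) (q w) ^ 4 ≤ ‖h‖ * ‖A‖ + ‖h‖ * ‖B‖ := by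
      have : ‖D * sizeSq (p w) (q w) ^ 2‖ = ‖D‖ * size (p w) (q w) ^ 4 := by
        rw [norm_mul, norm_pow, norm_sizeSq]; ring
      rw [← this, hD]
      refine (norm_add_le _ _).trans (le_of_eq ?_)
      simp
    refine le_of_mul_le_mul_right (h1.trans ?_) r4
    have := norm_nonneg h
    nlinarith
  apply key
  rw [← hAe, ← hBe]
  rw [add_mul, div_mul_cancel₀ _ (pow_ne_zero 2 hN)]
  simp only [map_mul]
  generalize conj (p w ^ 2 + w * q w + α) = Q'
  generalize conj (-q w ^ 2 - w * p w - β) = P'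
  push_cast
  ring

/-! ### The corrected energy along a rectifiable path -/

/-- The vector field of the system, as a function of `(z, (p, q))`. -/
def systemField (α β : ℂ) (x : ℂ × ℂ × ℂ) : ℂ × ℂ :=
  (-(x.2.2) ^ 2 - x.1 * x.2.1 - β, x.2.1 ^ 2 + x.1 * x.2.2 + α)

theorem contDiff_systemField (α β : ℂ) : ContDiff ℂ 1 (systemField α β) := by
  unfold systemField
  fun_prop

theorem hasDerivAt_systemField_iff {α β z : ℂ} {f : ℂ → ℂ × ℂ} :
    HasDerivAt f (systemField α β (z, f z)) z ↔
      HasDerivAt (fun z => (f z).2) ((f z).1 ^ 2 + z * (f z).2 + α) z ∧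
        HasDerivAt (fun z => (f z).1) (-((f z).2) ^ 2 - z * (f z).1 - β) z :=
  ⟨fun h => ⟨h.snd, h.fst⟩, fun h => h.2.prodMk h.1⟩

/-- All germs of a continuation of a solution are solutions. -/
theorem solution_along {α β a b : ℂ} {γ : Path a b} {F : unitInterval → ℂ → ℂ × ℂ}
    (hF : ContinuesAlong γ (Set.Iio 1) F)
    (h₀ : ∀ᶠ z in 𝓝 (γ 0), HasDerivAt (F 0) (systemField α β (z, F 0 z)) z)
    {t : unitInterval} (ht : t < 1) :
    ∀ᶠ z in 𝓝 (γ t), HasDerivAt (F t) (systemField α β (z, F t z)) z := by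
  let R : unitInterval → ℂ → ℂ × ℂ := fun t z => deriv (F t) z - systemField α β (z, F t z)
  have hR : ∀ t ∈ Set.Iio (1 : unitInterval), AnalyticAt ℂ (R t) (γ t) ∧
      ∀ᶠ s in 𝓝[Set.Iio 1] t, R s =ᶠ[𝓝 (γ s)] R t := by
    intro t ht
    have hFt := (hF t ht).1
    have h1 : AnalyticAt ℂ (fun z => (F t z).1) (γ t) := analyticAt_fst.comp hFt
    have h2 : AnalyticAt ℂ (fun z => (F t z).2) (γ t) := analyticAt_snd.comp hFt
    refine ⟨hFt.deriv.sub ?_, ?_⟩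
    · exact AnalyticAt.prod (((h2.pow 2).neg.sub (analyticAt_id.mul h1)).sub analyticAt_const)
        (((h1.pow 2).add (analyticAt_id.mul h2)).add analyticAt_const)
    · filter_upwards [(hF t ht).2] with s hs
      filter_upwards [hs, hs.deriv] with z hz hz'
      simp only [R, hz, hz']
  have hJ : IsPreconnected (Set.Iio (1 : unitInterval)) := isPreconnected_Iio
  have hR0 : R 0 =ᶠ[𝓝 (γ 0)] 0 := by
    filter_upwards [h₀] with z hz
    simp [R, hz.deriv]
  have h0 : (0 : unitInterval) ∈ Set.Iio (1 : unitInterval) := Set.mem_Iio.2 zero_lt_one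
  have := eventuallyEq_zero_along γ.continuous hJ hR h0 hR0 ht
  filter_upwards [this, (hF t ht).1.eventually_analyticAt] with z hz hz'
  have e : systemField α β (z, F t z) = deriv (F t) z := (sub_eq_zero.1 hz).symm
  rw [e]
  exact hz'.differentiableAt.hasDerivAt

/-- The logarithm of the corrected energy of a solution is Lipschitz. -/
theorem log_correctedEnergy_le {α β : ℂ} {c : ℝ} {f : ℂ → ℂ × ℂ} {S : Set ℂ} (hS : Convex ℝ S)
    (hc : ∀ z ∈ S, 1 + ‖z‖ + ‖α‖ + ‖β‖ ≤ c)
    (hf : ∀ z ∈ S, HasDerivAt f (systemField α β (z, f z)) z) {z w : ℂ} (hz : z ∈ S)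
    (hw : w ∈ S) :
    Real.log (1 + ‖correctedEnergy α β w (f w).1 (f w).2‖) -
      Real.log (1 + ‖correctedEnergy α β z (f z).1 (f z).2‖) ≤ (400 * c ^ 2 + 1) * dist w z := by
  set h := w - z with hh
  have hmem : ∀ x ∈ Set.Icc (0 : ℝ) 1, z + x * h ∈ S := by
    intro x hx
    have := hS.add_smul_sub_mem hz hw hx
    simpa using this
  have hder := fun x (hx : x ∈ Set.Icc (0 : ℝ) 1) =>
    exists_hasDerivAt_correctedEnergy (c := c) (p := fun z => (f z).1) (q := fun z => (f z).2)
      (hc _ (hmem x hx)) (hasDerivAt_systemField_iff.1 (hf _ (hmem x hx))).1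
      (hasDerivAt_systemField_iff.1 (hf _ (hmem x hx))).2
  set φ : ℝ → ℂ := fun s => correctedEnergy α β (z + s * h) (f (z + s * h)).1
    (f (z + s * h)).2 with hφ
  choose! D hD hDle using hder
  -- a positive rate makes the explicit form of the Grönwall bound available for `h = 0` too
  rcases eq_or_ne w z with rfl | hne
  · simp
  have hpos : 0 < dist w z := dist_pos.2 hne
  have hdist : ‖h‖ = dist w z := (dist_eq_norm w z).symm
  set K := (400 * c ^ 2 + 1) * dist w z with hK
  have hK0 : 0 < K := by positivity
  have hg := norm_le_gronwallBound_of_norm_deriv_right_le (f := φ) (f' := D) (δ := ‖φ 0‖) (K := K)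
    (ε := K) (a := 0) (b := 1) (fun x hx => (hD x hx).continuousAt.continuousWithinAt)
    (fun x hx => (hD x (Set.Ico_subset_Icc_self hx)).hasDerivWithinAt) le_rfl
    (fun x hx => by
      refine (hDle x (Set.Ico_subset_Icc_self hx)).trans ?_
      rw [hdist]
      have : 400 * c ^ 2 * dist w z ≤ K := by rw [hK]; gcongr; linarith
      have h2 : 0 ≤ 1 + ‖φ x‖ := by positivity
      calc _ ≤ K * (1 + ‖φ x‖) := mul_le_mul_of_nonneg_right this h2
        _ = K * ‖φ x‖ + K := by ring) 1 ⟨zero_le_one, le_rfl⟩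
  rw [gronwallBound_of_K_ne_0 hK0.ne'] at hg
  have e1 : φ 1 = correctedEnergy α β w (f w).1 (f w).2 := by simp [hφ, hh]
  have e0 : φ 0 = correctedEnergy α β z (f z).1 (f z).2 := by simp [hφ]
  rw [e1, e0] at hg
  simp only [sub_zero, mul_one, div_self hK0.ne', one_mul] at hg
  have p0 : 0 < 1 + ‖correctedEnergy α β z (f z).1 (f z).2‖ := by positivity
  have p1 : 0 < 1 + ‖correctedEnergy α β w (f w).1 (f w).2‖ := by positivity
  have h3 : 1 + ‖correctedEnergy α β w (f w).1 (f w).2‖ ≤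
      (1 + ‖correctedEnergy α β z (f z).1 (f z).2‖) * Real.exp K := by linarith
  have h4 := Real.log_le_log p1 h3
  rw [Real.log_mul p0.ne' (Real.exp_pos K).ne', Real.log_exp] at h4
  linarith

/-- A function that is locally Lipschitz with respect to a path of bounded variation is bounded,
with no assumption at the endpoint of the path. -/
theorem le_add_variation_of_locally_lipschitz {γ : unitInterval → ℂ}
    (hγ : BoundedVariationOn γ Set.univ) {g : unitInterval → ℝ} {C : ℝ} (hC : 0 ≤ C)
    (h : ∀ t < 1, ∃ U : Set unitInterval, IsOpen U ∧ t ∈ U ∧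
      ∀ s ∈ U, ∀ s' ∈ U, s < 1 → s' < 1 → g s - g s' ≤ C * dist (γ s) (γ s'))
    {T : unitInterval} (hT : T < 1) :
    g T ≤ g 0 + C * (eVariationOn γ Set.univ).toReal := by
  choose! U hUo hUt hU using h
  let c : unitInterval → Set unitInterval := fun t => if t < 1 then U t else Set.Ioi T
  have hco : ∀ t, IsOpen (c t) := by
    intro t
    by_cases ht : t < 1
    · simpa [c, ht] using hUo t ht
    · simpa [c, ht] using isOpen_Ioi
  have hcc : (Set.univ : Set unitInterval) ⊆ ⋃ t, c t := by
    intro t _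
    refine Set.mem_iUnion.2 ⟨t, ?_⟩
    by_cases ht : t < 1
    · simpa [c, ht] using hUt t ht
    · have : t = 1 := le_antisymm unitInterval.le_one' (not_lt.1 ht)
      simpa [c, ht] using this ▸ hT
  obtain ⟨u, hu0, hum, ⟨m, hm⟩, hcell⟩ :=
    exists_monotone_Icc_subset_open_cover_unitInterval hco hcc
  let v : ℕ → unitInterval := fun n => min (u n) T
  have hvm : Monotone v := fun a b hab => min_le_min_right _ (hum hab)
  have hv1 : ∀ n, v n < 1 := fun n => (min_le_right _ _).trans_lt hT
  have hstep : ∀ n, g (v (n + 1)) - g (v n) ≤ C * dist (γ (v (n + 1))) (γ (v n)) := by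
    intro n
    rcases lt_or_ge T (u n) with hn | hn
    · have e1 : v n = T := min_eq_right hn.le
      have e2 : v (n + 1) = T := min_eq_right (hn.le.trans (hum n.le_succ))
      simp [e1, e2]
    · obtain ⟨i, hi⟩ := hcell n
      have m0 : v n ∈ Set.Icc (u n) (u (n + 1)) := by
        have : v n = u n := min_eq_left hn
        rw [this]; exact ⟨le_rfl, hum n.le_succ⟩
      have m1 : v (n + 1) ∈ Set.Icc (u n) (u (n + 1)) :=
        ⟨le_min (hum n.le_succ) hn, min_le_left _ _⟩
      by_cases hi1 : i < 1
      · simp only [c, hi1, if_true] at hi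
        exact hU i hi1 _ (hi m1) _ (hi m0) (hv1 _) (hv1 _)
      · simp only [c, hi1, if_false] at hi
        exact absurd (hi ⟨le_rfl, hum n.le_succ⟩) (not_lt.2 hn)
  have hsum : ∀ n, g (v n) - g (v 0) ≤
      C * ∑ i ∈ Finset.range n, dist (γ (v (i + 1))) (γ (v i)) := by
    intro n
    induction n with
    | zero => simp
    | succ n ih => rw [Finset.sum_range_succ, mul_add]; linarith [hstep n]
  have hvar : ∑ i ∈ Finset.range m, dist (γ (v (i + 1))) (γ (v i)) ≤
      (eVariationOn γ Set.univ).toReal := by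
    have := eVariationOn.sum_le (f := γ) (s := Set.univ) (n := m) hvm fun _ => Set.mem_univ _
    have h2 := ENNReal.toReal_mono hγ this
    rw [ENNReal.toReal_sum fun _ _ => edist_ne_top _ _] at h2
    simpa [edist_dist, ENNReal.toReal_ofReal dist_nonneg] using h2
  have ev : v m = T := by simp [v, hm m le_rfl, unitInterval.le_one']
  have e0 : v 0 = 0 := by
    have hu0' : u 0 = 0 := hu0
    simp [v, hu0']
  have := hsum m
  rw [ev, e0] at this
  have h3 := mul_le_mul_of_nonneg_left hvar hC
  linarith

/-- The corrected energy of a solution stays bounded along a rectifiable path. -/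
theorem exists_bound_correctedEnergy {α β a b : ℂ} {γ : Path a b}
    (hγ : BoundedVariationOn γ Set.univ) {F : unitInterval → ℂ → ℂ × ℂ}
    (hF : ContinuesAlong γ (Set.Iio 1) F)
    (hsol : ∀ t < 1, ∀ᶠ z in 𝓝 (γ t), HasDerivAt (F t) (systemField α β (z, F t z)) z) :
    ∃ M : ℝ, ∀ t < 1,
      ‖correctedEnergy α β (γ t) (F t (γ t)).1 (F t (γ t)).2‖ ≤ M := by
  obtain ⟨Z, hZ⟩ := isCompact_univ.exists_bound_of_continuousOn γ.continuous.continuousOn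
  set c := 1 + (Z + 1) + ‖α‖ + ‖β‖ with hc
  let W : unitInterval → ℝ := fun t =>
    ‖correctedEnergy α β (γ t) (F t (γ t)).1 (F t (γ t)).2‖
  have hlip : ∀ T < 1, Real.log (1 + W T) ≤ Real.log (1 + W 0) +
      (400 * c ^ 2 + 1) * (eVariationOn γ Set.univ).toReal := by
    intro T hT
    refine le_add_variation_of_locally_lipschitz (g := fun t => Real.log (1 + W t)) hγ
      (by positivity) ?_ hT
    intro t ht
    obtain ⟨ε, hε, hball⟩ := Metric.eventually_nhds_iff_ball.1 (hsol t ht)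
    set r := min ε 1
    have hr : 0 < r := by positivity
    have ev : ∀ᶠ s in 𝓝 t, γ s ∈ Metric.ball (γ t) r ∧ (s < 1 → F s (γ s) = F t (γ s)) := by
      refine (γ.continuous.continuousAt.eventually (Metric.ball_mem_nhds _ hr)).and ?_
      have := eventually_nhdsWithin_iff.1 (hF t ht).2
      filter_upwards [this] with s hs h1
      exact (hs h1).self_of_nhds
    obtain ⟨U, hU, hUo, htU⟩ := eventually_nhds_iff.1 ev
    refine ⟨U, hUo, htU, fun s hs s' hs' h1 h1' => ?_⟩
    have := log_correctedEnergy_le (c := c) (S := Metric.ball (γ t) r) (f := F t)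
      (convex_ball _ _) (fun z hz => ?_)
      (fun z hz => hball z (Metric.ball_subset_ball (min_le_left _ _) hz)) (hU s' hs').1 (hU s hs).1
    · simp only [W, (hU s hs).2 h1, (hU s' hs').2 h1']
      exact this
    · have h2 : ‖z - γ t‖ < r := by simpa [dist_eq_norm] using hz
      have h3 := norm_add_le (γ t) (z - γ t)
      rw [add_sub_cancel] at h3
      have h4 := hZ t (Set.mem_univ _)
      have h5 : r ≤ 1 := min_le_right _ _
      rw [hc]; linarith
  refine ⟨Real.exp (Real.log (1 + W 0) +
      (400 * c ^ 2 + 1) * (eVariationOn γ Set.univ).toReal), fun T hT => ?_⟩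
  have h1 : 0 < 1 + W T := by positivity
  have := (Real.log_le_iff_le_exp h1).1 (hlip T hT)
  change W T ≤ _
  linarith

/-! ### Large values of a solution lie in a bounded part of one of the final charts -/

section CubeRoots

variable {ρ : ℂ}

theorem norm_of_cube_eq_one (hρ : ρ ^ 3 = 1) : ‖ρ‖ = 1 :=
  Complex.norm_eq_one_of_pow_eq_one hρ (by norm_num)

theorem conj_of_cube_eq_one (hρ : ρ ^ 3 = 1) : conj ρ = ρ ^ 2 := by
  have h : ρ * conj ρ = 1 := by
    rw [Complex.mul_conj, Complex.normSq_eq_norm_sq, norm_of_cube_eq_one hρ]; norm_num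
  calc conj ρ = ρ ^ 3 * conj ρ := by rw [hρ, one_mul]
    _ = ρ ^ 2 * (ρ * conj ρ) := by ring
    _ = ρ ^ 2 := by rw [h, mul_one]

theorem ne_zero_of_cube_eq_one (hρ : ρ ^ 3 = 1) : ρ ≠ 0 := by
  rintro rfl
  norm_num at hρ

theorem exists_primitive_cube_root : ∃ ω : ℂ, ω ^ 2 + ω + 1 = 0 := by
  have h := (Complex.isPrimitiveRoot_exp 3 (by norm_num)).geom_sum_eq_zero (by norm_num)
  simp only [Finset.sum_range_succ, Finset.sum_range_zero] at h
  exact ⟨_, by linear_combination h⟩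

/-- If `|p + ρ q| ≤ |p + ρ ω q|` for a primitive cube root of unity `ω`, then `p + ρ ω q` is as
large as `(p, q)`. -/
theorem size_le_of_norm_le {ω p q : ℂ} (hω : ω ^ 2 + ω + 1 = 0) (hρ : ρ ^ 3 = 1)
    (hr : 2 ≤ size p q) (h : ‖p + ρ * q‖ ≤ ‖p + ρ * ω * q‖) :
    size p q ≤ 4 * ‖p + ρ * ω * q‖ := by
  have hω3 : ω ^ 3 = 1 := by linear_combination (ω - 1) * hω
  have nω := norm_of_cube_eq_one hω3
  have nρ := norm_of_cube_eq_one hρ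
  have n1 : 1 ≤ ‖1 - ω‖ := by
    have e : (1 - ω) * (1 - ω) = 3 * -ω := by linear_combination hω
    have := congrArg norm e
    rw [norm_mul, norm_mul, norm_neg, nω, Complex.norm_ofNat] at this
    nlinarith [norm_nonneg (1 - ω)]
  have hq : ‖q‖ ≤ 2 * ‖p + ρ * ω * q‖ := by
    have e : ρ * (1 - ω) * q = (p + ρ * q) - (p + ρ * ω * q) := by ring
    have h2 := norm_sub_le (p + ρ * q) (p + ρ * ω * q)
    rw [← e, norm_mul, norm_mul, nρ, one_mul] at h2
    nlinarith [norm_nonneg q]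
  have hp : ‖p‖ ≤ 2 * ‖p + ρ * ω * q‖ := by
    have e : (1 - ω) * p = (p + ρ * ω * q) - ω * (p + ρ * q) := by ring
    have h2 := norm_sub_le (p + ρ * ω * q) (ω * (p + ρ * q))
    rw [← e, norm_mul, norm_mul, nω, one_mul] at h2
    nlinarith [norm_nonneg p]
  have hs := size_sq p q
  nlinarith [norm_nonneg p, norm_nonneg q, norm_nonneg (p + ρ * ω * q)]

/-- One of the three factors of `p ^ 3 + q ^ 3` is small. -/
theorem exists_norm_factor_mul_le (p q : ℂ) (hr : 2 ≤ size p q) :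
    ∃ ρ : ℂ, ρ ^ 3 = 1 ∧ ‖p + ρ * q‖ * size p q ^ 2 ≤ 16 * ‖p ^ 3 + q ^ 3‖ := by
  obtain ⟨ω, hω⟩ := exists_primitive_cube_root
  have hω3 : ω ^ 3 = 1 := by linear_combination (ω - 1) * hω
  have hω' : (ω ^ 2) ^ 2 + ω ^ 2 + 1 = 0 := by linear_combination (ω ^ 2 - ω + 1) * hω
  obtain ⟨k, -, hk⟩ := Finset.exists_min_image (Finset.range 3) (fun k => ‖p + ω ^ k * q‖)
    ⟨0, by simp⟩
  have hmin : ∀ m, ‖p + ω ^ k * q‖ ≤ ‖p + ω ^ m * q‖ := by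
    intro m
    have : ω ^ m = ω ^ (m % 3) := by
      conv_lhs => rw [← Nat.div_add_mod m 3, pow_add, pow_mul, hω3, one_pow, one_mul]
    rw [this]
    exact hk _ (Finset.mem_range.2 (Nat.mod_lt _ (by norm_num)))
  have hρ : (ω ^ k) ^ 3 = 1 := by rw [← pow_mul, mul_comm, pow_mul, hω3, one_pow]
  refine ⟨ω ^ k, hρ, ?_⟩
  have h1 := size_le_of_norm_le hω hρ hr (by
    have := hmin (k + 1); rwa [pow_succ] at this)
  have h2 := size_le_of_norm_le hω' hρ hr (by
    have := hmin (k + 2); rwa [pow_add] at this)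
  have e : p ^ 3 + q ^ 3 = (p + ω ^ k * q) * ((p + ω ^ k * ω * q) * (p + ω ^ k * ω ^ 2 * q)) := by
    generalize ω ^ k = ρ at hρ
    linear_combination (-q ^ 3) * hρ - (p + ρ * q) * (p * ρ * q + ρ ^ 2 * q ^ 2 * (ω - 1)) * hω
  rw [e, norm_mul, norm_mul]
  have h0 := size_pos p q
  calc _ = ‖p + ω ^ k * q‖ * (size p q * size p q) := by ring
    _ ≤ ‖p + ω ^ k * q‖ * ((4 * ‖p + ω ^ k * ω * q‖) * (4 * ‖p + ω ^ k * ω ^ 2 * q‖)) := by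
        gcongr
    _ = _ := by ring

end CubeRoots

/-- The second coordinate of the final chart over `ρ`, in terms of the original variables. -/
def chartV (α β ρ z p q : ℂ) : ℂ :=
  q * (1 - ρ ^ 2 * α + ρ * β - ρ ^ 2 * z * q + ρ * q ^ 2 + q * p)

/-- The Hamiltonian in terms of `s = p + ρ q` and `w = q (s - ρ² z)`. -/
theorem hamiltonian_eq {ρ : ℂ} (hρ : ρ ^ 3 = 1) (α β z s q : ℂ) :
    hamiltonian α β z (s - ρ * q) q =
      q * (ρ ^ 2 * (q * (s - ρ ^ 2 * z)) - α * ρ + β) + s ^ 3 / 3 -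
        ρ * s * (q * (s - ρ ^ 2 * z)) + α * s := by
  unfold hamiltonian
  linear_combination (-q ^ 3 / 3 + ρ * q ^ 2 * z - s * q * z) * hρ

theorem correction_sub_eq {ρ : ℂ} (hρ : ρ ^ 3 = 1) (s q : ℂ) :
    ((s - ρ * q) ^ 2 * conj q - q ^ 2 * conj (s - ρ * q)) / sizeSq (s - ρ * q) q - ρ ^ 2 * q =
      (-2 * ρ * s * q * conj q + s ^ 2 * conj q - q ^ 2 * conj s -
        ρ ^ 2 * q * (1 + s * conj s - s * (ρ ^ 2 * conj q) - ρ * q * conj s)) /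
          sizeSq (s - ρ * q) q := by
  rw [eq_div_iff (sizeSq_ne_zero _ _), sub_mul, div_mul_cancel₀ _ (sizeSq_ne_zero _ _)]
  simp only [sizeSq, map_sub, map_mul, conj_of_cube_eq_one hρ]
  linear_combination (-ρ ^ 2 * q ^ 2 * conj q) * hρ

theorem norm_correction_sub_le {ρ : ℂ} (hρ : ρ ^ 3 = 1) {s q : ℂ} {S : ℝ} (hs : ‖s‖ ≤ S)
    (hq : 1 ≤ ‖q‖) :
    ‖((s - ρ * q) ^ 2 * conj q - q ^ 2 * conj (s - ρ * q)) / sizeSq (s - ρ * q) q - ρ ^ 2 * q‖ ≤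
      1 + 5 * S + 2 * S ^ 2 := by
  have hS : 0 ≤ S := (norm_nonneg s).trans hs
  have nρ := norm_of_cube_eq_one hρ
  have hN : ‖q‖ ^ 2 ≤ size (s - ρ * q) q ^ 2 := by
    rw [size_sq]; nlinarith [sq_nonneg ‖s - ρ * q‖]
  rw [correction_sub_eq hρ, norm_div, norm_sizeSq,
    div_le_iff₀ (pow_pos (size_pos _ _) 2)]
  have b1 : ‖-2 * ρ * s * q * conj q‖ ≤ 2 * S * ‖q‖ ^ 2 := by
    simp only [norm_mul, norm_neg, nρ, Complex.norm_ofNat, Complex.norm_conj]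
    calc _ = 2 * ‖s‖ * ‖q‖ ^ 2 := by ring
      _ ≤ _ := by gcongr
  have b2 : ‖s ^ 2 * conj q‖ ≤ S ^ 2 * ‖q‖ ^ 2 := by
    simp only [norm_mul, norm_pow, Complex.norm_conj]
    gcongr
    nlinarith
  have b3 : ‖q ^ 2 * conj s‖ ≤ S * ‖q‖ ^ 2 := by
    simp only [norm_mul, norm_pow, Complex.norm_conj]
    rw [mul_comm]
    gcongr
  have b4 : ‖ρ ^ 2 * q * (1 + s * conj s - s * (ρ ^ 2 * conj q) - ρ * q * conj s)‖ ≤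
      (1 + S ^ 2 + 2 * S) * ‖q‖ ^ 2 := by
    have : ‖1 + s * conj s - s * (ρ ^ 2 * conj q) - ρ * q * conj s‖ ≤
        1 + S * S + S * ‖q‖ + ‖q‖ * S := by
      refine norm_sub_le_of_le (norm_sub_le_of_le (norm_add_le_of_le norm_one.le ?_) ?_) ?_
      · rw [norm_mul, Complex.norm_conj]; gcongr
      · rw [norm_mul, norm_mul, norm_pow, nρ, Complex.norm_conj]; simp only [one_pow, one_mul]
        gcongr
      · rw [norm_mul, norm_mul, nρ, Complex.norm_conj, one_mul]; gcongr
    rw [norm_mul, norm_mul, norm_pow, nρ, one_pow, one_mul]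
    calc _ ≤ ‖q‖ * (1 + S * S + S * ‖q‖ + ‖q‖ * S) := by gcongr
      _ ≤ ‖q‖ * (1 * ‖q‖ + S * S * ‖q‖ + S * ‖q‖ + ‖q‖ * S) := by
          have h1 := le_mul_of_one_le_right (mul_nonneg hS hS) hq
          gcongr
          linarith
      _ = _ := by ring
  refine (norm_sub_le_of_le (norm_sub_le_of_le (norm_add_le_of_le b1 b2) b3) b4).trans ?_
  calc _ = (1 + 5 * S + 2 * S ^ 2) * ‖q‖ ^ 2 := by ring
    _ ≤ _ := by gcongr

/-- Where the corrected energy is bounded, a large point `(p, q)` lies in a bounded part of one of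
the final charts: `p + ρ q`, then `q (p + ρ q - ρ² z)`, and then the second coordinate are bounded,
the last one being the corrected energy up to a bounded term. -/
theorem exists_chart_bound (α β : ℂ) (Z M : ℝ) :
    ∃ R K : ℝ, ∀ z p q : ℂ, ‖z‖ ≤ Z → ‖correctedEnergy α β z p q‖ ≤ M → R ≤ size p q →
      ∃ ρ : ℂ, ρ ^ 3 = 1 ∧ q ≠ 0 ∧ ‖q⁻¹‖ ≤ K ∧ ‖chartV α β ρ z p q‖ ≤ K := by
  set c := 1 + |Z| + ‖α‖ + ‖β‖ with hc
  have hc1 : 1 ≤ c := by rw [hc]; linarith [abs_nonneg Z, norm_nonneg α, norm_nonneg β]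
  -- `S` bounds `p + ρ q`, and `B` bounds `q (p + ρ q - ρ² z)`
  set S := 16 * (3 * |M| + 6 + 3 * c) with hS
  have hS0 : 0 ≤ S := by positivity
  set B := 2 * (|M| + 8 + c + S ^ 3 + c * S) with hB
  have hB0 : 0 ≤ B := by positivity
  refine ⟨8 * (S + 1), 1 + |M| + (1 + 5 * S + 2 * S ^ 2) + S ^ 3 + S * B + c * S, ?_⟩
  intro z p q hz hW hR
  have hW' : ‖correctedEnergy α β z p q‖ ≤ |M| := hW.trans (le_abs_self M)
  have hzc : 1 + ‖z‖ + ‖α‖ + ‖β‖ ≤ c := by rw [hc]; linarith [le_abs_self Z]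
  have hr2 : 2 ≤ size p q := by linarith
  obtain ⟨ρ, hρ, hfac⟩ := exists_norm_factor_mul_le p q hr2
  have nρ := norm_of_cube_eq_one hρ
  have hH := norm_hamiltonian_le α β z p q
  have hE := norm_cubes_le (p := p) (q := q) hzc
  have r0 := size_pos p q
  have hs : ‖p + ρ * q‖ ≤ S := by
    have h1 : ‖p ^ 3 + q ^ 3‖ ≤ (3 * |M| + 6 + 3 * c) * size p q ^ 2 := by
      have : 1 ≤ size p q := by linarith
      have h2 : size p q ≤ size p q ^ 2 := by nlinarith
      nlinarith [abs_nonneg M, pow_pos r0 2]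
    have h3 : ‖p + ρ * q‖ * size p q ^ 2 ≤ S * size p q ^ 2 := by
      rw [hS]; linarith
    exact le_of_mul_le_mul_right h3 (pow_pos r0 2)
  obtain ⟨s, rfl⟩ : ∃ s, p = s - ρ * q := ⟨p + ρ * q, by ring⟩
  rw [sub_add_cancel] at hs
  have hpq : ‖s - ρ * q‖ ≤ S + ‖q‖ := by
    refine norm_sub_le_of_le hs ?_
    rw [norm_mul, nρ, one_mul]
  have hrq : size (s - ρ * q) q ≤ 1 + S + 2 * ‖q‖ := by
    refine abs_le_of_sq_le_sq' ?_ (by positivity) |>.2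
    rw [size_sq]
    nlinarith [norm_nonneg q, norm_nonneg (s - ρ * q)]
  have hq2 : 2 * (S + 1) ≤ ‖q‖ := by linarith
  have hrq' : size (s - ρ * q) q ≤ 4 * ‖q‖ := by linarith
  have hq1 : 1 ≤ ‖q‖ := by linarith
  have hq0 : q ≠ 0 := by rintro rfl; norm_num at hq1
  set w := q * (s - ρ ^ 2 * z) with hw
  have hαc : ‖α‖ ≤ c := by rw [hc]; linarith [abs_nonneg Z, norm_nonneg β]
  have hαβ : ‖α * ρ - β‖ ≤ c := by
    refine (norm_sub_le _ _).trans ?_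
    rw [norm_mul, nρ, mul_one, hc]
    linarith [abs_nonneg Z]
  have hs3 : ‖s ^ 3 / 3‖ ≤ S ^ 3 := by
    rw [norm_div, norm_pow, Complex.norm_ofNat]
    have : ‖s‖ ^ 3 ≤ S ^ 3 := by gcongr
    have h3 : 0 ≤ ‖s‖ ^ 3 := by positivity
    linarith
  have hαs : ‖α * s‖ ≤ c * S := by rw [norm_mul]; gcongr
  have hHeq := hamiltonian_eq hρ α β z s q
  rw [← hw] at hHeq
  have hwB : ‖w‖ ≤ B := by
    have e : w * (ρ ^ 2 * q - ρ * s) =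
        hamiltonian α β z (s - ρ * q) q + q * (α * ρ - β) - s ^ 3 / 3 - α * s := by
      rw [hHeq]; ring
    have h1 : ‖q‖ / 2 ≤ ‖ρ ^ 2 * q - ρ * s‖ := by
      have := norm_sub_norm_le (ρ ^ 2 * q) (ρ * s)
      rw [norm_mul, norm_mul, norm_pow, nρ, one_pow, one_mul, one_mul] at this
      linarith
    have h2 : ‖hamiltonian α β z (s - ρ * q) q + q * (α * ρ - β) - s ^ 3 / 3 - α * s‖ ≤
        (|M| + 2 * (4 * ‖q‖)) + ‖q‖ * c + S ^ 3 + c * S := by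
      refine norm_sub_le_of_le (norm_sub_le_of_le (norm_add_le_of_le ?_ ?_) hs3) hαs
      · linarith
      · rw [norm_mul]; gcongr
    rw [← e, norm_mul] at h2
    have h3 : (|M| + 2 * (4 * ‖q‖)) + ‖q‖ * c + S ^ 3 + c * S ≤ B * (‖q‖ / 2) := by
      have k1 := le_mul_of_one_le_right (abs_nonneg M) hq1
      have k2 := le_mul_of_one_le_right (by positivity : 0 ≤ S ^ 3) hq1
      have k3 := le_mul_of_one_le_right (by positivity : 0 ≤ c * S) hq1
      rw [hB]; linarith
    have h4 : ‖w‖ * (‖q‖ / 2) ≤ B * (‖q‖ / 2) :=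
      (mul_le_mul_of_nonneg_left h1 (norm_nonneg w)).trans (h2.trans h3)
    exact le_of_mul_le_mul_right h4 (by linarith)
  refine ⟨ρ, hρ, hq0, ?_, ?_⟩
  · rw [norm_inv]
    have h1 : ‖q‖⁻¹ ≤ 1 := inv_le_one_of_one_le₀ hq1
    have : 0 ≤ |M| + (1 + 5 * S + 2 * S ^ 2) + S ^ 3 + S * B + c * S := by positivity
    linarith
  · have hcor := norm_correction_sub_le hρ hs hq1
    have e : ρ ^ 2 * chartV α β ρ z (s - ρ * q) q =
        correctedEnergy α β z (s - ρ * q) q -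
        (((s - ρ * q) ^ 2 * conj q - q ^ 2 * conj (s - ρ * q)) / sizeSq (s - ρ * q) q - ρ ^ 2 * q) -
        s ^ 3 / 3 + ρ * s * w - α * s := by
      rw [correctedEnergy, hHeq, hw, chartV]
      linear_combination (-q * ρ * α + q * β) * hρ
    have n : ‖chartV α β ρ z (s - ρ * q) q‖ = ‖ρ ^ 2 * chartV α β ρ z (s - ρ * q) q‖ := by
      rw [norm_mul, norm_pow, nρ, one_pow, one_mul]
    rw [n, e]
    have hsw : ‖ρ * s * w‖ ≤ S * B := by
      rw [norm_mul, norm_mul, nρ, one_mul]; gcongr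
    refine (norm_sub_le_of_le (norm_add_le_of_le (norm_sub_le_of_le
      (norm_sub_le_of_le hW' hcor) hs3) hsw) hαs).trans ?_
    linarith

/-! ### The system in a final chart -/

/-- The second coordinate of the last centre of blow-up, with its sign reversed. -/
def chartShift (α β ρ : ℂ) : ℂ := 1 - ρ ^ 2 * α + ρ * β

/-- The original variables `(p, q)` in terms of the final chart `(u, v)` over `ρ`, for `u ≠ 0`. -/
def ofChart (α β ρ z : ℂ) (y : ℂ × ℂ) : ℂ × ℂ :=
  (y.1 ^ 2 * y.2 - chartShift α β ρ * y.1 + ρ ^ 2 * z - ρ * y.1⁻¹, y.1⁻¹)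

/-- The vector field of the system in the final chart over `ρ`, as a function of `(z, (u, v))`.
It is polynomial: the centres of the blow-ups are such that all its poles along `u = 0` cancel. -/
def chartField (α β ρ : ℂ) (x : ℂ × ℂ × ℂ) : ℂ × ℂ :=
  (-((x.2.1 ^ 3 * x.2.2 - chartShift α β ρ * x.2.1 ^ 2 + ρ ^ 2 * x.1 * x.2.1 - ρ) ^ 2
      + x.1 * x.2.1 + α * x.2.1 ^ 2),
    -(α * chartShift α β ρ) - x.1 * x.2.2 - ρ * chartShift α β ρ ^ 2
      - ρ * x.1 ^ 2 * chartShift α β ρ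
      + x.2.1 * (2 * α * x.2.2 + 4 * ρ * x.2.2 * chartShift α β ρ + 2 * ρ * x.1 ^ 2 * x.2.2
        + 2 * ρ ^ 2 * x.1 * chartShift α β ρ ^ 2)
      - x.2.1 ^ 2 * (chartShift α β ρ ^ 3 + 3 * ρ * x.2.2 ^ 2
        + 6 * ρ ^ 2 * x.1 * x.2.2 * chartShift α β ρ)
      + x.2.1 ^ 3 * (4 * x.2.2 * chartShift α β ρ ^ 2 + 4 * ρ ^ 2 * x.1 * x.2.2 ^ 2)
      - 5 * x.2.1 ^ 4 * x.2.2 ^ 2 * chartShift α β ρ + 2 * x.2.1 ^ 5 * x.2.2 ^ 3)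

theorem contDiff_chartField (α β ρ : ℂ) : ContDiff ℂ 1 (chartField α β ρ) := by
  unfold chartField
  fun_prop

theorem ofChart_inv_chartV {α β ρ z p q : ℂ} (hq : q ≠ 0) :
    ofChart α β ρ z (q⁻¹, chartV α β ρ z p q) = (p, q) := by
  simp only [ofChart, chartV, chartShift, inv_inv]
  refine Prod.ext ?_ rfl
  field_simp
  ring

theorem chartV_ofChart {α β ρ z u v : ℂ} (hu : u ≠ 0) :
    chartV α β ρ z (ofChart α β ρ z (u, v)).1 (ofChart α β ρ z (u, v)).2 = v := by
  simp only [ofChart, chartV, chartShift]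
  field_simp
  ring

theorem hasDerivAt_ofChart {α β ρ z : ℂ} (hρ : ρ ^ 3 = 1) {U : ℂ → ℂ × ℂ}
    (hU : HasDerivAt U (chartField α β ρ (z, U z)) z) (h0 : (U z).1 ≠ 0) :
    HasDerivAt (fun z => ofChart α β ρ z (U z)) (systemField α β (z, ofChart α β ρ z (U z))) z := by
  have hu : HasDerivAt (fun z => (U z).1) (chartField α β ρ (z, U z)).1 z := hU.fst
  have hv : HasDerivAt (fun z => (U z).2) (chartField α β ρ (z, U z)).2 z := hU.snd
  have hi := hu.inv h0
  have hp := (((hu.pow 2).mul hv).sub (hu.const_mul (chartShift α β ρ))).add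
    ((hasDerivAt_id z).const_mul (ρ ^ 2)) |>.sub (hi.const_mul ρ)
  refine HasDerivAt.prodMk (hp.congr_deriv ?_) (hi.congr_deriv ?_)
  · simp only [ofChart, chartField, Pi.pow_apply]
    have hk : chartShift α β ρ = 1 - ρ ^ 2 * α + ρ * β := rfl
    generalize chartShift α β ρ = k at hk
    generalize (U z).1 = u at *
    generalize (U z).2 = v at *
    field_simp
    grind
  · simp only [ofChart, chartField]
    field_simp

/-! ### Laurent expansions at the poles -/

/-- The first step of the Taylor expansion, with an analytic remainder. -/
theorem exists_analyticAt_remainder {f : ℂ → ℂ} {a : ℂ} (hf : AnalyticAt ℂ f a) :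
    ∃ g : ℂ → ℂ, AnalyticAt ℂ g a ∧ g a = deriv f a ∧ ∀ z, f z = f a + (z - a) * g z := by
  obtain ⟨p, hp⟩ := hf
  refine ⟨dslope f a, ⟨_, hp.has_fpower_series_dslope_fslope⟩, dslope_same f a, fun z => ?_⟩
  have := sub_smul_dslope f a z
  rw [smul_eq_mul] at this
  rw [this]; ring

/-- Comparison of the lowest coefficients. -/
theorem eq_zero_of_eventually_add_mul {a e : ℂ} {g : ℂ → ℂ} (hg : ContinuousAt g a)
    (h : ∀ᶠ z in 𝓝[≠] a, e + (z - a) * g z = 0) : e = 0 ∧ ∀ᶠ z in 𝓝[≠] a, g z = 0 := by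
  have hc : ContinuousAt (fun z => e + (z - a) * g z) a := by fun_prop
  have h1 : Filter.Tendsto (fun z => e + (z - a) * g z) (𝓝[≠] a) (𝓝 e) := by
    have := hc.tendsto.mono_left (nhdsWithin_le_nhds (s := {a}ᶜ))
    simpa using this
  have he : e = 0 := tendsto_nhds_unique h1 (tendsto_const_nhds.congr' (h.mono fun z hz => hz.symm))
  refine ⟨he, ?_⟩
  filter_upwards [h, self_mem_nhdsWithin] with z hz hne
  rw [he, zero_add] at hz
  exact (mul_eq_zero.1 hz).resolve_left (sub_ne_zero.2 hne)

theorem two_coefficients_eq_zero {a e₀ e₁ : ℂ} {r : ℂ → ℂ} (hr : ContinuousAt r a)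
    (h : ∀ᶠ z in 𝓝[≠] a, e₀ + (z - a) * (e₁ + (z - a) * r z) = 0) :
    e₀ = 0 ∧ e₁ = 0 ∧ ∀ᶠ z in 𝓝[≠] a, r z = 0 := by
  obtain ⟨h0, h⟩ := eq_zero_of_eventually_add_mul (by fun_prop) h
  obtain ⟨h1, h⟩ := eq_zero_of_eventually_add_mul hr h
  exact ⟨h0, h1, h⟩

theorem four_coefficients_eq_zero {a e₀ e₁ e₂ e₃ : ℂ} {r : ℂ → ℂ} (hr : ContinuousAt r a)
    (h : ∀ᶠ z in 𝓝[≠] a,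
      e₀ + (z - a) * (e₁ + (z - a) * (e₂ + (z - a) * (e₃ + (z - a) * r z))) = 0) :
    e₀ = 0 ∧ e₁ = 0 ∧ e₂ = 0 ∧ e₃ = 0 := by
  obtain ⟨h0, h1, h⟩ := two_coefficients_eq_zero (by fun_prop) h
  obtain ⟨h2, h3, -⟩ := two_coefficients_eq_zero hr h
  exact ⟨h0, h1, h2, h3⟩

theorem exists_eventually_hasSum {f : ℂ → ℂ} {a : ℂ} (hf : AnalyticAt ℂ f a) :
    ∃ c : ℕ → ℂ, ∀ᶠ z in 𝓝 a, HasSum (fun n => c n * (z - a) ^ n) (f z) := by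
  obtain ⟨p, hp⟩ := hf
  refine ⟨p.coeff, ?_⟩
  filter_upwards [hp.eventually_hasSum_sub] with z hz
  simpa [FormalMultilinearSeries.apply_eq_pow_smul_coeff, mul_comm] using hz

/-- The coefficients of `A = a₀ + a₁ x + ⋯` and of `1 / A = -ρ² + G₁ x + ⋯` for a solution
`q = A / x` of the system that passes through the point `(0, c)` of the final chart. The equations
are the comparison of coefficients in the equation for `q'`, with `p` expressed by the chart; they
have no resonance because `c` is given. -/
theorem expansion_coefficients {α β zs c ρ a₀ a₁ a₂ a₃ G₁ : ℂ} (hρ : ρ ^ 3 = 1)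
    (hG₀ : a₀ * -ρ ^ 2 = 1) (hG₁ : a₀ * G₁ + a₁ * -ρ ^ 2 = 0)
    {b₀ b₁ b₂ b₃ : ℂ} (hb₀ : b₀ = -ρ * a₀) (hb₁ : b₁ = ρ ^ 2 * zs - ρ * a₁)
    (hb₂ : b₂ = ρ ^ 2 + chartShift α β ρ * ρ ^ 2 - ρ * a₂)
    (hb₃ : b₃ = ρ * c - chartShift α β ρ * G₁ - ρ * a₃)
    (h1 : -(2 * b₀ * b₁) - zs * a₀ = 0)
    (h2 : a₂ - (2 * b₀ * b₂ + b₁ ^ 2) - zs * a₁ - a₀ - α = 0)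
    (h3 : 2 * a₃ - (2 * b₀ * b₃ + 2 * b₁ * b₂) - zs * a₂ - a₁ = 0) :
    a₀ = -ρ ∧ a₁ = ρ * zs / 2 ∧
      a₂ = ρ * (1 + zs ^ 2 / 4) - α / 3 + 2 / 3 * ρ ^ 2 * β ∧
      a₃ = c / 2 + (-α / 2 + 7 * ρ / 8 + β * ρ ^ 2 / 2) * zs ∧
      b₀ = ρ ^ 2 ∧ b₁ = ρ ^ 2 * zs / 2 ∧
      b₂ = ρ ^ 2 * (1 - zs ^ 2 / 4) - 2 / 3 * ρ * α + β / 3 ∧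
      b₃ = c * ρ / 2 - 3 * ρ ^ 2 * zs / 8 := by
  have e0 : a₀ = -ρ := by linear_combination -a₀ * hρ - ρ * hG₀
  subst e0
  have f0 : b₀ = ρ ^ 2 := by rw [hb₀]; ring
  subst f0
  have e1 : a₁ = ρ * zs / 2 := by
    linear_combination h1 / 2 + ρ ^ 2 * hb₁ + (ρ * zs - a₁) * hρ
  subst e1
  have f1 : b₁ = ρ ^ 2 * zs / 2 := by rw [hb₁]; ring
  subst f1
  have g1 : G₁ = -(ρ ^ 2 * zs / 2) := by
    linear_combination -ρ ^ 2 * hG₁ - (G₁ + ρ ^ 2 * zs / 2) * hρ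
  subst g1
  unfold chartShift at hb₂ hb₃
  have e2 : a₂ = ρ * (1 + zs ^ 2 / 4) - α / 3 + 2 / 3 * ρ ^ 2 * β := by
    linear_combination h2 / 3 + 2 / 3 * ρ ^ 2 * hb₂ + (-2 / 3 * a₂ - 2 / 3 * α + 4 / 3 * ρ +
      ρ * zs ^ 2 / 12 + 2 / 3 * ρ ^ 2 * β - 2 / 3 * ρ ^ 3 * α) * hρ
  have f2 : b₂ = ρ ^ 2 * (1 - zs ^ 2 / 4) - 2 / 3 * ρ * α + β / 3 := by
    linear_combination hb₂ - ρ * e2 + (β / 3 - ρ * α) * hρ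
  rw [e2, f2] at h3
  have e3 : a₃ = c / 2 + (-α / 2 + 7 * ρ / 8 + β * ρ ^ 2 / 2) * zs := by
    linear_combination h3 / 4 + ρ ^ 2 / 2 * hb₃ + (-a₃ / 2 + c / 2 - 5 / 12 * α * zs +
      ρ * zs / 2 - ρ * zs ^ 3 / 16 + ρ ^ 2 * β * zs / 4 - ρ ^ 3 * α * zs / 4) * hρ
  have f3 : b₃ = c * ρ / 2 - 3 * ρ ^ 2 * zs / 8 := by
    linear_combination hb₃ - ρ * e3 - ρ * α * zs / 2 * hρ
  exact ⟨rfl, rfl, e2, e3, rfl, rfl, f2, f3⟩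

theorem hasPoleExpansion_ofChart {α β zs c : ℂ} (ρ : CubeRoot) {U : ℂ → ℂ × ℂ}
    (hU : AnalyticAt ℂ U zs)
    (hsol : ∀ᶠ z in 𝓝 zs, HasDerivAt U (chartField α β ρ (z, U z)) z) (h0 : U zs = (0, c)) :
    (∀ᶠ z in 𝓝[≠] zs, (U z).1 ≠ 0) ∧
      HasPoleExpansion α β zs ρ
        (c / 2 + (-α / 2 + 7 * ρ / 8 + β * conj (ρ : ℂ) / 2) * zs)
        (c * ρ / 2 - 3 * conj (ρ : ℂ) * zs / 8)
        (fun z => (ofChart α β ρ z (U z)).1) (fun z => (ofChart α β ρ z (U z)).2) := by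
  obtain ⟨ρ, hρ⟩ := ρ
  simp only [HasPoleExpansion]
  rw [conj_of_cube_eq_one hρ]
  have hρ0 := ne_zero_of_cube_eq_one hρ
  have hu : AnalyticAt ℂ (fun z => (U z).1) zs := analyticAt_fst.comp hU
  have hv : AnalyticAt ℂ (fun z => (U z).2) zs := analyticAt_snd.comp hU
  have hu0 : (U zs).1 = 0 := by rw [h0]
  have hv0 : (U zs).2 = c := by rw [h0]
  have hdu : deriv (fun z => (U z).1) zs = -ρ ^ 2 := by
    have : HasDerivAt (fun z => (U z).1) (chartField α β ρ (zs, U zs)).1 zs :=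
      hsol.self_of_nhds.fst
    rw [this.deriv, h0]
    simp [chartField]
  obtain ⟨G, hG, hGs, hGeq⟩ := exists_analyticAt_remainder hu
  simp only [hu0, zero_add] at hGeq
  rw [hdu] at hGs
  have hG0 : G zs ≠ 0 := by rw [hGs]; exact neg_ne_zero.2 (pow_ne_zero 2 hρ0)
  have hA : AnalyticAt ℂ (fun z => (G z)⁻¹) zs := hG.inv hG0
  obtain ⟨G1, hG1, -, hG1eq⟩ := exists_analyticAt_remainder hG
  obtain ⟨G2, hG2, -, hG2eq⟩ := exists_analyticAt_remainder hG1
  obtain ⟨v1, hv1, -, hv1eq⟩ := exists_analyticAt_remainder hv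
  obtain ⟨A1, hA1, -, hA1eq⟩ := exists_analyticAt_remainder hA
  obtain ⟨A2, hA2, -, hA2eq⟩ := exists_analyticAt_remainder hA1
  obtain ⟨A3, hA3, -, hA3eq⟩ := exists_analyticAt_remainder hA2
  obtain ⟨A4, hA4, -, hA4eq⟩ := exists_analyticAt_remainder hA3
  simp only [hv0] at hv1eq
  rw [hGs] at hG1eq
  set a₀ := (G zs)⁻¹ with ha₀
  set a₁ := A1 zs
  set a₂ := A2 zs
  set a₃ := A3 zs
  set g₁ := G1 zs
  set k := chartShift α β ρ with hk
  -- the coefficients of `x p`, where `x = z - zs`, as given by the chart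
  set b₀ := -ρ * a₀ with hb₀
  set b₁ := ρ ^ 2 * zs - ρ * a₁ with hb₁
  set b₂ := ρ ^ 2 + k * ρ ^ 2 - ρ * a₂ with hb₂
  set b₃ := ρ * c - k * g₁ - ρ * a₃ with hb₃
  -- the remainder of fourth order of `x p`
  let B4 : ℂ → ℂ := fun z => -ρ * A4 z - k * G2 z +
    ((2 * -ρ ^ 2 * G1 z + (z - zs) * G1 z ^ 2) * (U z).2 + ρ ^ 4 * v1 z)
  have hB4 : AnalyticAt ℂ B4 zs := by
    refine ((analyticAt_const.mul hA4).sub (analyticAt_const.mul hG2)).add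
      ((((analyticAt_const.mul hG1).add
        ((analyticAt_id.sub analyticAt_const).mul (hG1.pow 2))).mul hv).add
        (analyticAt_const.mul hv1))
  have hGne : ∀ᶠ z in 𝓝[≠] zs, G z ≠ 0 :=
    nhdsWithin_le_nhds (hG.continuousAt.eventually_ne hG0)
  have hx : ∀ᶠ z in 𝓝[≠] zs, z - zs ≠ 0 := by
    filter_upwards [self_mem_nhdsWithin] with z hz
    exact sub_ne_zero.2 hz
  have hune : ∀ᶠ z in 𝓝[≠] zs, (U z).1 ≠ 0 := by
    filter_upwards [hGne, hx] with z h1 h2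
    rw [hGeq]
    exact mul_ne_zero h2 h1
  have hAser : ∀ z, (G z)⁻¹ = a₀ + a₁ * (z - zs) + a₂ * (z - zs) ^ 2 + a₃ * (z - zs) ^ 3 +
      (z - zs) ^ 4 * A4 z := by
    intro z
    rw [hA1eq, hA2eq, hA3eq, hA4eq]; ring
  have hq : ∀ z, (z - zs) ≠ 0 → G z ≠ 0 → (z - zs) * (ofChart α β ρ z (U z)).2 = (G z)⁻¹ := by
    intro z h1 h2
    simp only [ofChart, hGeq]
    field_simp
  have hp : ∀ z, (z - zs) ≠ 0 → G z ≠ 0 → (z - zs) * (ofChart α β ρ z (U z)).1 =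
      b₀ + b₁ * (z - zs) + b₂ * (z - zs) ^ 2 + b₃ * (z - zs) ^ 3 + (z - zs) ^ 4 * B4 z := by
    intro z h1 h2
    have e : (z - zs) * (ofChart α β ρ z (U z)).1 =
        (z - zs) ^ 3 * G z ^ 2 * (U z).2 - k * ((z - zs) ^ 2 * G z) + ρ ^ 2 * z * (z - zs) -
          ρ * (G z)⁻¹ := by
      simp only [ofChart, hGeq, ← hk]
      field_simp
    have e2 : G z ^ 2 * (U z).2 = ρ * c + (z - zs) *
        ((2 * -ρ ^ 2 * G1 z + (z - zs) * G1 z ^ 2) * (U z).2 + ρ ^ 4 * v1 z) := by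
      rw [hG1eq z]
      linear_combination (ρ ^ 4) * hv1eq z + c * ρ * hρ
    have e3 : G z = -ρ ^ 2 + g₁ * (z - zs) + (z - zs) ^ 2 * G2 z := by
      rw [hG1eq, hG2eq]; ring
    rw [e, mul_assoc ((z - zs) ^ 3), e2, hAser z]
    simp only [B4]
    linear_combination (-k * (z - zs) ^ 2) * e3
  -- the differential equation for `q`, multiplied by `x ^ 2`
  have hode : ∀ᶠ z in 𝓝[≠] zs, (z - zs) * deriv (fun z => (G z)⁻¹) z - (G z)⁻¹ =
      ((z - zs) * (ofChart α β ρ z (U z)).1) ^ 2 + z * (z - zs) * (G z)⁻¹ +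
        α * (z - zs) ^ 2 := by
    have ev : ∀ᶠ z in 𝓝[≠] zs, (fun z => (G z)⁻¹) =ᶠ[𝓝 z]
        fun z => (z - zs) * (ofChart α β ρ z (U z)).2 := by
      have := eventually_eventually_nhdsWithin.2 (hGne.and hx)
      filter_upwards [this, self_mem_nhdsWithin] with z hz hne
      rw [IsOpen.nhdsWithin_eq isOpen_compl_singleton hne] at hz
      filter_upwards [hz] with w hw
      exact (hq w hw.2 hw.1).symm
    filter_upwards [ev, hx, hGne, hune, nhdsWithin_le_nhds hsol] with z h1 h2 h3 h4 h5
    have hd := (hasDerivAt_ofChart hρ h5 h4)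
    have hd2 : HasDerivAt (fun z => (ofChart α β ρ z (U z)).2)
      ((ofChart α β ρ z (U z)).1 ^ 2 + z * (ofChart α β ρ z (U z)).2 + α) z :=
      (hasDerivAt_systemField_iff.1 hd).1
    have hm : HasDerivAt (fun z => (z - zs) * (ofChart α β ρ z (U z)).2) _ z :=
      ((hasDerivAt_id z).sub_const zs).mul hd2
    rw [h1.deriv_eq, hm.deriv, ← hq z h2 h3]
    simp only [id]
    ring
  have hdA : ∀ᶠ z in 𝓝[≠] zs, deriv (fun z => (G z)⁻¹) z =
      a₁ + 2 * a₂ * (z - zs) + 3 * a₃ * (z - zs) ^ 2 + 4 * (z - zs) ^ 3 * A4 z +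
        (z - zs) ^ 4 * deriv A4 z := by
    filter_upwards [nhdsWithin_le_nhds hA4.eventually_analyticAt] with z hz
    have hfun : (fun z => (G z)⁻¹) = fun z => a₀ + a₁ * (z - zs) + a₂ * (z - zs) ^ 2 +
      a₃ * (z - zs) ^ 3 + (z - zs) ^ 4 * A4 z := funext hAser
    have hX := (hasDerivAt_id z).sub_const zs
    rw [hfun]
    refine (((((hX.const_mul a₁).const_add a₀).add ((hX.pow 2).const_mul a₂)).add
      ((hX.pow 3).const_mul a₃)).add
        ((hX.pow 4).mul hz.differentiableAt.hasDerivAt)).deriv.trans ?_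
    simp only [id, Pi.pow_apply]
    push_cast
    ring
  have hA4' : ContinuousAt A4 zs := hA4.continuousAt
  have hA4d : ContinuousAt (deriv A4) zs := hA4.deriv.continuousAt
  have hB4' : ContinuousAt B4 zs := hB4.continuousAt
  have hG1' := hG1.continuousAt
  have hG2' := hG2.continuousAt
  let r : ℂ → ℂ := fun z => 3 * A4 z + (z - zs) * deriv A4 z -
    (2 * b₁ * b₃ + b₂ ^ 2 + (z - zs) * (2 * b₂ * b₃) + (z - zs) ^ 2 * b₃ ^ 2 +
      2 * B4 z * (b₀ + b₁ * (z - zs) + b₂ * (z - zs) ^ 2 + b₃ * (z - zs) ^ 3) +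
      (z - zs) ^ 4 * B4 z ^ 2) -
    (zs * (a₃ + (z - zs) * A4 z) + a₂ + a₃ * (z - zs) + (z - zs) ^ 2 * A4 z)
  have hr : ContinuousAt r zs := by
    clear_value B4 a₀ a₁ a₂ a₃ b₀ b₁ b₂ b₃
    fun_prop
  have hcmp : ∀ᶠ z in 𝓝[≠] zs, (-a₀ - b₀ ^ 2) + (z - zs) * ((-(2 * b₀ * b₁) - zs * a₀) +
      (z - zs) * ((a₂ - (2 * b₀ * b₂ + b₁ ^ 2) - zs * a₁ - a₀ - α) +
      (z - zs) * ((2 * a₃ - (2 * b₀ * b₃ + 2 * b₁ * b₂) - zs * a₂ - a₁) +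
      (z - zs) * r z))) = 0 := by
    filter_upwards [hode, hdA, hx, hGne] with z h1 h2 h3 h4
    rw [h2, hp z h3 h4, hAser z] at h1
    simp only [r]
    linear_combination h1
  obtain ⟨-, c1, c2, c3⟩ := four_coefficients_eq_zero hr hcmp
  have hinv : ∀ᶠ z in 𝓝[≠] zs, (a₀ * -ρ ^ 2 - 1) + (z - zs) * ((a₀ * g₁ + a₁ * -ρ ^ 2) +
      (z - zs) * (a₀ * G2 z + A2 z * -ρ ^ 2 + A1 z * G1 z)) = 0 := by
    filter_upwards [hGne] with z h1
    have h2 : (G z)⁻¹ * G z = 1 := inv_mul_cancel₀ h1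
    rw [hA1eq z, hG1eq z] at h2
    linear_combination h2 + (-a₀ * (z - zs)) * hG2eq z + (ρ ^ 2 * (z - zs)) * hA2eq z
  have hA1' := hA1.continuousAt
  have hA2' := hA2.continuousAt
  have hr' : ContinuousAt (fun z => a₀ * G2 z + A2 z * -ρ ^ 2 + A1 z * G1 z) zs :=
    ((continuousAt_const.mul hG2').add (hA2'.mul continuousAt_const)).add (hA1'.mul hG1')
  obtain ⟨i0, i1, -⟩ := two_coefficients_eq_zero hr' hinv
  obtain ⟨e0, e1, e2, e3, f0, f1, f2, f3⟩ := expansion_coefficients (c := c) hρ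
    (sub_eq_zero.1 i0) i1 hb₀ hb₁ hb₂ hb₃ c1 c2 c3
  refine ⟨hune, ?_⟩
  obtain ⟨cs, hcs⟩ := exists_eventually_hasSum hA4
  obtain ⟨ds, hds⟩ := exists_eventually_hasSum hB4
  refine ⟨cs, ds, ?_⟩
  filter_upwards [nhdsWithin_le_nhds hcs, nhdsWithin_le_nhds hds, hx, hGne] with z h1 h2 h3 h4
  constructor
  · have e : (ofChart α β ρ z (U z)).2 - (-ρ / (z - zs) + ρ * zs / 2 +
        (ρ * (1 + zs ^ 2 / 4) - α / 3 + 2 / 3 * ρ ^ 2 * β) * (z - zs) +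
        (c / 2 + (-α / 2 + 7 * ρ / 8 + β * ρ ^ 2 / 2) * zs) * (z - zs) ^ 2) =
        (z - zs) ^ 3 * A4 z := by
      have h5 := hq z h3 h4
      rw [hAser z, e0, e1, e2, e3] at h5
      refine mul_left_cancel₀ h3 ?_
      rw [mul_sub, h5]
      field_simp
      ring
    rw [e]
    refine (h1.mul_left ((z - zs) ^ 3)).congr_fun fun n => ?_
    ring
  · have e : (ofChart α β ρ z (U z)).1 - (ρ ^ 2 / (z - zs) + ρ ^ 2 * zs / 2 +
        (ρ ^ 2 * (1 - zs ^ 2 / 4) - 2 / 3 * ρ * α + β / 3) * (z - zs) +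
        (c * ρ / 2 - 3 * ρ ^ 2 * zs / 8) * (z - zs) ^ 2) = (z - zs) ^ 3 * B4 z := by
      have h5 := hp z h3 h4
      rw [f0, f1, f2, f3] at h5
      refine mul_left_cancel₀ h3 ?_
      rw [mul_sub, h5]
      field_simp
      ring
    rw [e]
    refine (h2.mul_left ((z - zs) ^ 3)).congr_fun fun n => ?_
    ring

/-! ### Points of the space of initial conditions -/

theorem fst_eq_zero_of_mem_tangentConeAt {S : Set (ℂ × ℂ)} {x y : ℂ × ℂ}
    (hS : ∀ w ∈ S, w.1 = x.1) (hy : y ∈ tangentConeAt ℂ S x) : y.1 = 0 := by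
  obtain ⟨ι, l, hl, c, d, -, hmem, hlim⟩ := exists_fun_of_mem_tangentConeAt hy
  have h1 : Filter.Tendsto (fun n => (c n • d n).1) l (𝓝 y.1) :=
    (continuous_fst.tendsto y).comp hlim
  refine tendsto_nhds_unique h1 (tendsto_const_nhds.congr' ?_)
  filter_upwards [hmem] with n hn
  have : (d n).1 = 0 := by simpa using hS _ hn
  simp [this]

section Blowup

variable {X : CoordSurface} {I : Type} [Inhabited I] (c : Centres X I)

/-- In the chart in which the centre is given, the curve is contained in the line through the
centre on which the first coordinate is constant; its only direction there is `[0 : 1]`. -/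
theorem inr_notMem_strictTransform {C : Set X.Carrier} {i : I} {d : ℙ ℂ (Fin 2 → ℂ)}
    (hd : d.rep 0 ≠ 0)
    (hC : ∀ x ∈ C, x ∈ (X.chart (c.idx i)).source → (X.chart (c.idx i) x).1 = (c.pos i).1) :
    Sum.inr (i, d) ∉ strictTransform c C := by
  rintro (⟨x, hx, -⟩ | ⟨j, d', h, -, hcone⟩)
  · exact Sum.inr_ne_inl hx
  · obtain ⟨rfl, rfl⟩ := Prod.mk.inj (Sum.inr.inj h)
    refine hd (fst_eq_zero_of_mem_tangentConeAt ?_ hcone)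
    rintro _ ⟨x, ⟨hx, hs⟩, rfl⟩
    exact hC x hx hs

theorem inr_notMem_strictTransform_of_notMem {C : Set X.Carrier} {i : I} {d : ℙ ℂ (Fin 2 → ℂ)}
    (hC : c.pt i ∉ C) : Sum.inr (i, d) ∉ strictTransform c C := by
  rintro (⟨x, hx, -⟩ | ⟨j, d', h, hpt, -⟩)
  · exact Sum.inr_ne_inl hx
  · obtain ⟨rfl, rfl⟩ := Prod.mk.inj (Sum.inr.inj h)
    exact hC hpt

theorem inl_mem_strictTransform_iff {C : Set X.Carrier} {x : {x : X.Carrier // ∀ i, x ≠ c.pt i}} :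
    Sum.inl x ∈ strictTransform c C ↔ x.1 ∈ C := by
  constructor
  · rintro (⟨y, hy, hyC⟩ | ⟨j, d, h, -⟩)
    · rwa [Sum.inl.inj hy]
    · exact absurd h Sum.inl_ne_inr
  · exact fun h => Or.inl ⟨x, rfl, h⟩

theorem inl_notMem_exceptional {i : I} {x : {x : X.Carrier // ∀ i, x ≠ c.pt i}} :
    Sum.inl x ∉ exceptional c i := by
  rintro ⟨d, h⟩
  exact Sum.inl_ne_inr h

/-- On the exceptional curve, the first coordinate of the second chart vanishes. -/
theorem second_fst_eq_zero_of_mem_exceptional {i j : I} {x : (blowup c).Carrier}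
    (hx : x ∈ exceptional c j) : ((blowup c).chart (.second i) x).1 = 0 := by
  obtain ⟨d, rfl⟩ := hx
  rfl

end Blowup

section Surfaces

variable (α β z : ℂ)

theorem rep_one_left_ne_zero (b : ℂ) :
    (Projectivization.mk ℂ ![1, b] (vec2_ne 0 rfl)).rep 0 ≠ 0 := by
  rw [rep_mk_ne_zero]
  simp

theorem pt_centres₂ (ρ : CubeRoot) : (centres₂ z).pt ρ =
    Sum.inr (ρ, Projectivization.mk ℂ ![1, conj (ρ : ℂ) * z] (vec2_ne 0 rfl)) :=
  second_symm_zero centres₁ ρ _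

theorem pt_centres₃ (ρ : CubeRoot) : (centres₃ α β z).pt ρ =
    Sum.inr (ρ, Projectivization.mk ℂ ![1, conj (ρ : ℂ) * α - ρ * β - 1] (vec2_ne 0 rfl)) :=
  second_symm_zero (centres₂ z) ρ _

/-- The point of the third exceptional curve over `ρ` with second coordinate `b`. -/
def polePoint (ρ : CubeRoot) (b : ℂ) : (compactSurface α β z).Carrier :=
  Sum.inr (ρ, Projectivization.mk ℂ ![1, b] (vec2_ne 0 rfl))

theorem second_symm_eq_polePoint (ρ : CubeRoot) (b : ℂ) :
    (finalChart α β z ρ).symm (0, b) = polePoint α β z ρ b :=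
  second_symm_zero (centres₃ α β z) ρ b

theorem pt_centres₂_notMem_line (ρ : CubeRoot) :
    (centres₂ z).pt ρ ∉ strictTransform centres₁ lineAtInfinity := by
  rw [pt_centres₂]
  refine inr_notMem_strictTransform centres₁ (rep_one_left_ne_zero _) ?_
  intro x hx _
  have hx0 : Projectivization.rep (K := ℂ) (V := Fin 3 → ℂ) x 0 = 0 := hx
  change ratio x 0 1 = 0
  simp [ratio, hx0]

theorem polePoint_mem_initialSpace (ρ : CubeRoot) (b : ℂ) :
    polePoint α β z ρ b ∈ initialSpace α β z := by
  rintro (h | h)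
  · refine inr_notMem_strictTransform_of_notMem (centres₃ α β z) ?_ h
    rw [pt_centres₃]
    exact inr_notMem_strictTransform_of_notMem (centres₂ z) (pt_centres₂_notMem_line z ρ)
  · obtain ⟨σ, h | h⟩ := Set.mem_iUnion.1 h
    · refine inr_notMem_strictTransform_of_notMem (centres₃ α β z) ?_ h
      rw [pt_centres₃]
      exact inr_notMem_strictTransform (centres₂ z) (rep_one_left_ne_zero _)
        fun x hx _ => second_fst_eq_zero_of_mem_exceptional centres₁ hx
    · exact inr_notMem_strictTransform (centres₃ α β z) (rep_one_left_ne_zero _)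
        (fun x hx _ => second_fst_eq_zero_of_mem_exceptional (centres₂ z) hx) h

theorem polePoint_mem_curveL₃ (ρ : CubeRoot) (b : ℂ) :
    polePoint α β z ρ b ∈ curveL₃ α β z ρ := ⟨_, rfl⟩

theorem polePoint_notMem_originalChart_source (ρ : CubeRoot) (b : ℂ) :
    polePoint α β z ρ b ∉ (originalChart α β z).source := by
  rintro ⟨⟨x, hx, -⟩, -⟩
  exact Sum.inr_ne_inl hx

theorem zero_mem_finalChart_target (ρ : CubeRoot) (b : ℂ) :
    ((0, b) : ℂ × ℂ) ∈ (finalChart α β z ρ).target := by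
  refine ⟨second_target_zero (centres₃ α β z) ρ b, ?_⟩
  have := polePoint_mem_initialSpace α β z ρ b
  rw [← second_symm_eq_polePoint] at this
  exact this

theorem polePoint_mem_finalChart_source (ρ : CubeRoot) (b : ℂ) :
    polePoint α β z ρ b ∈ (finalChart α β z ρ).source := by
  rw [← second_symm_eq_polePoint]
  exact (finalChart α β z ρ).map_target (zero_mem_finalChart_target α β z ρ b)

theorem finalChart_polePoint (ρ : CubeRoot) (b : ℂ) :
    finalChart α β z ρ (polePoint α β z ρ b) = (0, b) := by
  rw [← second_symm_eq_polePoint]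
  exact (finalChart α β z ρ).right_inv (zero_mem_finalChart_target α β z ρ b)

/-- The point `[1 : q : p]` of the projective plane. -/
def planePoint (p q : ℂ) : projectivePlane.Carrier :=
  Projectivization.mk ℂ ![1, q, p] (vec3_ne 0 rfl)

theorem planePoint_rep (p q : ℂ) :
    Projectivization.rep (K := ℂ) (V := Fin 3 → ℂ) (planePoint p q) 0 ≠ 0 := by
  unfold planePoint
  rw [rep_mk_ne_zero]
  simp

theorem planePoint_ne (p q : ℂ) (ρ : CubeRoot) : planePoint p q ≠ centres₁.pt ρ := by
  intro h
  refine planePoint_rep p q ?_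
  rw [h]
  change Projectivization.rep (Projectivization.mk ℂ ![0, 1, -(ρ : ℂ)] (vec3_ne 1 rfl)) 0 = 0
  by_contra hne
  rw [← ne_eq, rep_mk_ne_zero] at hne
  simp at hne

/-- The point `[1 : q : p]` in the first blow-up. -/
def planePoint₁ (p q : ℂ) : surface₁.Carrier :=
  Sum.inl ⟨planePoint p q, planePoint_ne p q⟩

theorem planePoint₁_ne (p q : ℂ) (ρ : CubeRoot) : planePoint₁ p q ≠ (centres₂ z).pt ρ := by
  rw [pt_centres₂]
  exact Sum.inl_ne_inr

/-- The point `[1 : q : p]` in the second blow-up. -/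
def planePoint₂ (p q : ℂ) : (surface₂ z).Carrier :=
  Sum.inl ⟨planePoint₁ p q, planePoint₁_ne z p q⟩

theorem planePoint₂_ne (p q : ℂ) (ρ : CubeRoot) : planePoint₂ z p q ≠ (centres₃ α β z).pt ρ := by
  rw [pt_centres₃]
  exact Sum.inl_ne_inr

theorem point_eq (p q : ℂ) :
    point α β z (p, q) = Sum.inl ⟨planePoint₂ z p q, planePoint₂_ne α β z p q⟩ := by
  have h1 : (surface₁.chart (.old .pq)).symm (p, q) = planePoint₁ p q :=
    centres₁.place_of_ne _ _ (planePoint_ne p q)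
  have h2 : ((surface₂ z).chart (.old (.old .pq))).symm (p, q) = planePoint₂ z p q := by
    change (centres₂ z).place default ((surface₁.chart (.old .pq)).symm (p, q)) _ = _
    rw [h1]
    exact (centres₂ z).place_of_ne _ _ (planePoint₁_ne z p q)
  change (centres₃ α β z).place default
    (((surface₂ z).chart (.old (.old .pq))).symm (p, q)) _ = _
  rw [h2]
  exact (centres₃ α β z).place_of_ne _ _ (planePoint₂_ne α β z p q)

theorem point_mem_initialSpace (p q : ℂ) : point α β z (p, q) ∈ initialSpace α β z := by
  rw [point_eq]
  rintro (h | h)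
  · have h' := (inl_mem_strictTransform_iff _).1 ((inl_mem_strictTransform_iff _).1
      ((inl_mem_strictTransform_iff _).1 h))
    exact planePoint_rep p q h'
  · obtain ⟨σ, h | h⟩ := Set.mem_iUnion.1 h
    · exact inl_notMem_exceptional centres₁ ((inl_mem_strictTransform_iff _).1
        ((inl_mem_strictTransform_iff _).1 h))
    · exact inl_notMem_exceptional (centres₂ z) ((inl_mem_strictTransform_iff _).1 h)

variable {p q : ℂ}

theorem uChart_planePoint (p q : ℂ) :
    projectivePlane.chart .u (planePoint p q) = (q⁻¹, p / q) := by
  change (ratio (Projectivization.mk ℂ ![1, q, p] (vec3_ne 0 rfl)) 0 1,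
    ratio (Projectivization.mk ℂ ![1, q, p] (vec3_ne 0 rfl)) 2 1) = _
  simp [ratio_mk]

theorem secondChart_planePoint₁ (ρ : CubeRoot) (hq : q ≠ 0) :
    surface₁.chart (.second ρ) (planePoint₁ p q) = (q⁻¹, p + ρ * q) := by
  change ((projectivePlane.chart .u (planePoint p q)).1 - 0,
    ((projectivePlane.chart .u (planePoint p q)).2 - -(ρ : ℂ)) /
      ((projectivePlane.chart .u (planePoint p q)).1 - 0)) = _
  rw [uChart_planePoint]
  ext <;> simp
  field_simp

theorem planePoint₁_mem_source (ρ : CubeRoot) (hq : q ≠ 0) :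
    planePoint₁ p q ∈ (surface₁.chart (.second ρ)).source := by
  refine Or.inl ⟨_, rfl, ?_, ?_⟩
  · change Projectivization.rep (Projectivization.mk ℂ ![1, q, p] (vec3_ne 0 rfl)) 1 ≠ 0
    rw [rep_mk_ne_zero]
    simpa using hq
  · change (projectivePlane.chart .u (planePoint p q)).1 ≠ 0
    rw [uChart_planePoint]
    exact inv_ne_zero hq

theorem secondChart_planePoint₂ (ρ : CubeRoot) (hq : q ≠ 0) :
    (surface₂ z).chart (.second ρ) (planePoint₂ z p q) =
      (q⁻¹, (p + ρ * q - conj (ρ : ℂ) * z) * q) := by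
  change ((surface₁.chart (.second ρ) (planePoint₁ p q)).1 - 0,
    ((surface₁.chart (.second ρ) (planePoint₁ p q)).2 - conj (ρ : ℂ) * z) /
      ((surface₁.chart (.second ρ) (planePoint₁ p q)).1 - 0)) = _
  rw [secondChart_planePoint₁ ρ hq]
  ext <;> simp

theorem planePoint₂_mem_source (ρ : CubeRoot) (hq : q ≠ 0) :
    planePoint₂ z p q ∈ ((surface₂ z).chart (.second ρ)).source := by
  refine Or.inl ⟨_, rfl, planePoint₁_mem_source ρ hq, ?_⟩
  change (surface₁.chart (.second ρ) (planePoint₁ p q)).1 ≠ 0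
  rw [secondChart_planePoint₁ ρ hq]
  exact inv_ne_zero hq

theorem point_mem_finalChart_source (ρ : CubeRoot) (hq : q ≠ 0) :
    point α β z (p, q) ∈ (finalChart α β z ρ).source := by
  refine ⟨?_, point_mem_initialSpace α β z p q⟩
  rw [point_eq]
  refine Or.inl ⟨_, rfl, planePoint₂_mem_source z ρ hq, ?_⟩
  change ((surface₂ z).chart (.second ρ) (planePoint₂ z p q)).1 ≠ 0
  rw [secondChart_planePoint₂ z ρ hq]
  exact inv_ne_zero hq

theorem finalChart_point (ρ : CubeRoot) (hq : q ≠ 0) :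
    finalChart α β z ρ (point α β z (p, q)) = (q⁻¹, chartV α β ρ z p q) := by
  rw [point_eq]
  change (((surface₂ z).chart (.second ρ) (planePoint₂ z p q)).1 - 0,
    (((surface₂ z).chart (.second ρ) (planePoint₂ z p q)).2 -
      (conj (ρ : ℂ) * α - ρ * β - 1)) /
      (((surface₂ z).chart (.second ρ) (planePoint₂ z p q)).1 - 0)) = _
  rw [secondChart_planePoint₂ z ρ hq, conj_of_cube_eq_one ρ.2]
  ext
  · simp
  · simp [chartV]
    ring

theorem finalChart_point_ofChart (ρ : CubeRoot) {y : ℂ × ℂ} (hy : y.1 ≠ 0) :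
    finalChart α β z ρ (point α β z (ofChart α β ρ z y)) = y := by
  have h := chartV_ofChart (α := α) (β := β) (ρ := ρ) (z := z) (v := y.2) hy
  have h2 := finalChart_point α β z (p := (ofChart α β ρ z y).1) ρ
    (q := (ofChart α β ρ z y).2) (inv_ne_zero hy)
  rw [h2]
  refine Prod.ext ?_ h
  simp [ofChart]

end Surfaces

/-! ### Continuation to the endpoint -/

theorem norm_pair_le_size (p q : ℂ) : ‖((p, q) : ℂ × ℂ)‖ ≤ size p q :=
  max_le (norm_left_le_size p q) (norm_right_le_size p q)

theorem continuesAlong_of_eventuallyEq {a b : ℂ} {γ : Path a b} {F : unitInterval → ℂ → ℂ × ℂ}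
    (hF : ContinuesAlong γ (Set.Iio 1) F) {g : ℂ → ℂ × ℂ} (hg : AnalyticAt ℂ g b)
    (h : ∀ᶠ t in 𝓝[<] (1 : unitInterval), F t =ᶠ[𝓝 (γ t)] g) :
    ContinuesAlong γ Set.univ fun t => if t < 1 then F t else g := by
  intro t _
  rw [nhdsWithin_univ]
  rcases lt_or_ge t 1 with ht | ht
  · simp only [ht, if_true]
    refine ⟨(hF t ht).1, ?_⟩
    have h1 := eventually_nhdsWithin_iff.1 (hF t ht).2
    filter_upwards [h1, Iio_mem_nhds ht] with s hs hs1
    rw [if_pos (Set.mem_Iio.1 hs1)]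
    exact hs hs1
  · obtain rfl : t = 1 := le_antisymm unitInterval.le_one' ht
    simp only [lt_irrefl, if_false, γ.target]
    refine ⟨hg, ?_⟩
    filter_upwards [eventually_nhdsWithin_iff.1 h] with s hs
    by_cases hs1 : s < 1
    · rw [if_pos hs1]
      exact hs hs1
    · rw [if_neg hs1]

section Endpoint

variable {α β a b : ℂ} {γ : Path a b} {F : unitInterval → ℂ → ℂ × ℂ}

theorem isPreconnected_Ico_one (t : unitInterval) : IsPreconnected (Set.Ico t 1) :=
  isPreconnected_Ico

theorem continuesAlong_restrict (hF : ContinuesAlong γ (Set.Iio 1) F) {t₁ t : unitInterval}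
    (ht : t ∈ Set.Ico t₁ 1) :
    AnalyticAt ℂ (F t) (γ t) ∧ ∀ᶠ s in 𝓝[Set.Ico t₁ 1] t, F s =ᶠ[𝓝 (γ s)] F t :=
  ⟨(hF t ht.2).1, nhdsWithin_mono t (fun _ h => h.2) (hF t ht.2).2⟩

/-- A solution of the system on a set that contains the last part of the path and has the right
value at one parameter continues all later germs. -/
theorem eventuallyEq_along_of_solution (hF : ContinuesAlong γ (Set.Iio 1) F)
    (hsol : ∀ t < 1, ∀ᶠ z in 𝓝 (γ t), HasDerivAt (F t) (systemField α β (z, F t z)) z)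
    {t₁ : unitInterval} (ht₁ : t₁ < 1) {y : ℂ → ℂ × ℂ} {S : Set ℂ} (hS : IsOpen S)
    (hy : ∀ z ∈ S, HasDerivAt y (systemField α β (z, y z)) z)
    (hγS : ∀ t ∈ Set.Ico t₁ 1, γ t ∈ S) (h : y (γ t₁) = F t₁ (γ t₁)) {t : unitInterval}
    (ht : t ∈ Set.Ico t₁ 1) : F t =ᶠ[𝓝 (γ t)] y := by
  have hmem : t₁ ∈ Set.Ico t₁ 1 := ⟨le_rfl, ht₁⟩
  have hd : DifferentiableOn ℂ y S := fun z hz => (hy z hz).differentiableAt.differentiableWithinAt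
  have h0 := eventuallyEq_of_hasDerivAt (contDiff_systemField α β) (hsol t₁ ht₁)
    (Filter.eventually_of_mem (hS.mem_nhds (hγS t₁ hmem)) hy) h.symm
  have := eventuallyEq_zero_along (R := fun t z => F t z - y z) γ.continuous
    (isPreconnected_Ico_one t₁) (fun t ht => ?_) hmem
    (h0.mono fun z hz => sub_eq_zero.2 hz) ht
  · exact this.mono fun z hz => sub_eq_zero.1 hz
  · obtain ⟨h1, h2⟩ := continuesAlong_restrict hF ht
    exact ⟨h1.sub (hd.analyticAt (hS.mem_nhds (hγS t ht))),
      h2.mono fun s hs => hs.mono fun z hz => by simp only [hz]⟩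

theorem analyticAt_ofChart {ρ z : ℂ} {U : ℂ → ℂ × ℂ} (hU : AnalyticAt ℂ U z) (h0 : (U z).1 ≠ 0) :
    AnalyticAt ℂ (fun z => ofChart α β ρ z (U z)) z := by
  have h1 : AnalyticAt ℂ (fun z => (U z).1) z := analyticAt_fst.comp hU
  have h2 : AnalyticAt ℂ (fun z => (U z).2) z := analyticAt_snd.comp hU
  have h3 := h1.inv h0
  exact AnalyticAt.prod (((((h1.pow 2).mul h2).sub (analyticAt_const.mul h1)).add
    (analyticAt_const.mul analyticAt_id)).sub (analyticAt_const.mul h3)) h3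

/-- A solution in a final chart that has the right value at one parameter continues all later germs.
The conclusion includes that the path avoids the zeros of the first coordinate: there the germs of
`q` would have poles. -/
theorem eventuallyEq_ofChart_along_of_solution {ρ : ℂ} (hρ : ρ ^ 3 = 1)
    (hF : ContinuesAlong γ (Set.Iio 1) F)
    (hsol : ∀ t < 1, ∀ᶠ z in 𝓝 (γ t), HasDerivAt (F t) (systemField α β (z, F t z)) z)
    {t₁ : unitInterval} (ht₁ : t₁ < 1) {U : ℂ → ℂ × ℂ} {S : Set ℂ} (hS : IsOpen S)
    (hU : ∀ z ∈ S, HasDerivAt U (chartField α β ρ (z, U z)) z)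
    (hγS : ∀ t ∈ Set.Ico t₁ 1, γ t ∈ S) (hq : (F t₁ (γ t₁)).2 ≠ 0)
    (h : U (γ t₁) = ((F t₁ (γ t₁)).2⁻¹,
      chartV α β ρ (γ t₁) (F t₁ (γ t₁)).1 (F t₁ (γ t₁)).2)) {t : unitInterval}
    (ht : t ∈ Set.Ico t₁ 1) :
    ∀ᶠ z in 𝓝 (γ t), (U z).1 ≠ 0 ∧ F t z = ofChart α β ρ z (U z) := by
  have hmem : t₁ ∈ Set.Ico t₁ 1 := ⟨le_rfl, ht₁⟩
  have hd : DifferentiableOn ℂ U S := fun z hz => (hU z hz).differentiableAt.differentiableWithinAt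
  have hUan : ∀ t ∈ Set.Ico t₁ 1, AnalyticAt ℂ U (γ t) := fun t ht =>
    hd.analyticAt (hS.mem_nhds (hγS t ht))
  have hu1 : (U (γ t₁)).1 ≠ 0 := by
    rw [h]; exact inv_ne_zero hq
  have hne : ∀ᶠ z in 𝓝 (γ t₁), (U z).1 ≠ 0 :=
    (continuous_fst.continuousAt.comp (hUan t₁ hmem).continuousAt).eventually_ne hu1
  have h0 : F t₁ =ᶠ[𝓝 (γ t₁)] fun z => ofChart α β ρ z (U z) := by
    refine eventuallyEq_of_hasDerivAt (contDiff_systemField α β) (hsol t₁ ht₁) ?_ ?_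
    · filter_upwards [hne, hS.mem_nhds (hγS t₁ hmem)] with z hz hzS
      exact hasDerivAt_ofChart hρ (hU z hzS) hz
    · rw [h, ofChart_inv_chartV hq]
  -- the relation `F t = ofChart U` with its denominators cleared
  let R : unitInterval → ℂ → ℂ × ℂ := fun t z => ((F t z).2 * (U z).1 - 1,
    (F t z).1 - ((U z).1 ^ 2 * (U z).2 - chartShift α β ρ * (U z).1 + ρ ^ 2 * z - ρ * (F t z).2))
  have := eventuallyEq_zero_along (R := R) γ.continuous
    (isPreconnected_Ico_one t₁) (fun t ht => ?_) hmem ?_ ht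
  · filter_upwards [this] with z hz
    have e1 : (F t z).2 * (U z).1 = 1 := sub_eq_zero.1 (congrArg Prod.fst hz)
    have e2 := sub_eq_zero.1 (congrArg Prod.snd hz)
    have e3 : (U z).1 ≠ 0 := right_ne_zero_of_mul_eq_one e1
    have e4 : (F t z).2 = (U z).1⁻¹ := eq_inv_of_mul_eq_one_left e1
    refine ⟨e3, Prod.ext ?_ e4⟩
    rw [e2, e4]
    rfl
  · obtain ⟨h1, h2⟩ := continuesAlong_restrict hF ht
    have f1 : AnalyticAt ℂ (fun z => (F t z).1) (γ t) := analyticAt_fst.comp h1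
    have f2 : AnalyticAt ℂ (fun z => (F t z).2) (γ t) := analyticAt_snd.comp h1
    have u1 : AnalyticAt ℂ (fun z => (U z).1) (γ t) := analyticAt_fst.comp (hUan t ht)
    have u2 : AnalyticAt ℂ (fun z => (U z).2) (γ t) := analyticAt_snd.comp (hUan t ht)
    refine ⟨AnalyticAt.prod ((f2.mul u1).sub analyticAt_const) (f1.sub
      (((((u1.pow 2).mul u2).sub (analyticAt_const.mul u1)).add
        (analyticAt_const.mul analyticAt_id)).sub (analyticAt_const.mul f2))), ?_⟩
    exact h2.mono fun s hs => hs.mono fun z hz => by simp only [R, hz]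
  · filter_upwards [h0, hne] with z hz hz0
    simp only [R, hz]
    simp [ofChart, hz0]

/-- Near the end of the path the solution lies in a part of `ℂ²` or of a final chart that is
bounded independently of the parameter, so that the radius of existence reaches beyond the
endpoint. In the first case the continuation to the endpoint is regular. -/
theorem continues_or_exists_chart_solution (hγ : BoundedVariationOn γ Set.univ)
    (hF : ContinuesAlong γ (Set.Iio 1) F)
    (hsol : ∀ t < 1, ∀ᶠ z in 𝓝 (γ t), HasDerivAt (F t) (systemField α β (z, F t z)) z) :
    (∃ g, AnalyticAt ℂ g b ∧ ∀ᶠ t in 𝓝[<] (1 : unitInterval), F t =ᶠ[𝓝 (γ t)] g) ∨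
    ∃ (ρ : CubeRoot) (U : ℂ → ℂ × ℂ),
      (∀ᶠ z in 𝓝 b, HasDerivAt U (chartField α β ρ (z, U z)) z) ∧
      ∀ᶠ t in 𝓝[<] (1 : unitInterval), ∀ᶠ z in 𝓝 (γ t),
        (U z).1 ≠ 0 ∧ F t z = ofChart α β ρ z (U z) := by
  obtain ⟨M, hM⟩ := exists_bound_correctedEnergy hγ hF hsol
  obtain ⟨Z, hZ⟩ := isCompact_univ.exists_bound_of_continuousOn γ.continuous.continuousOn
  obtain ⟨R, K, hRK⟩ := exists_chart_bound α β Z M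
  have hev : ∀ δ > 0, ∃ l < (1 : unitInterval), ∀ t ∈ Set.Ioo l 1, dist (γ t) b < δ := by
    intro δ hδ
    have h1 : ∀ᶠ t in 𝓝[<] (1 : unitInterval), dist (γ t) b < δ := by
      have := γ.continuous.tendsto 1
      rw [γ.target] at this
      exact nhdsWithin_le_nhds (this.eventually (Metric.ball_mem_nhds b hδ))
    obtain ⟨l, hl, hl2⟩ := (mem_nhdsLT_iff_exists_Ioo_subset' zero_lt_one).1 h1
    exact ⟨l, hl, hl2⟩
  have hgeom : ∀ (δ : ℝ) (l t₁ : unitInterval), (∀ t ∈ Set.Ioo l 1, dist (γ t) b < δ / 2) →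
      t₁ ∈ Set.Ioo l 1 → b ∈ Metric.ball (γ t₁) δ ∧
        ∀ t ∈ Set.Ico t₁ 1, γ t ∈ Metric.ball (γ t₁) δ := by
    intro δ l t₁ h ht₁
    have h1 := h t₁ ht₁
    have h0 := dist_nonneg (x := γ t₁) (y := b)
    refine ⟨by rw [Metric.mem_ball, dist_comm]; linarith, fun t ht => ?_⟩
    have h2 := h t ⟨ht₁.1.trans_le ht.1, ht.2⟩
    have h3 := dist_triangle_right (γ t) (γ t₁) b
    rw [Metric.mem_ball]
    linarith
  have : (𝓝[<] (1 : unitInterval)).NeBot := nhdsLT_neBot_of_exists_lt ⟨0, zero_lt_one⟩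
  by_cases hcase : ∃ᶠ t in 𝓝[<] (1 : unitInterval), size (F t (γ t)).1 (F t (γ t)).2 < R
  · left
    obtain ⟨δ, hδ, hex⟩ := exists_uniform_radius (contDiff_systemField α β) Z R
    obtain ⟨l, hl, hball⟩ := hev (δ / 2) (half_pos hδ)
    obtain ⟨t₁, hsize, ht₁⟩ := (hcase.and_eventually (Ioo_mem_nhdsLT hl)).exists
    obtain ⟨hb, hγS⟩ := hgeom δ l t₁ hball ht₁
    obtain ⟨y, hy1, hy⟩ := hex (γ t₁) (F t₁ (γ t₁)) (hZ t₁ (Set.mem_univ _))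
      ((norm_pair_le_size _ _).trans hsize.le)
    have hd : DifferentiableOn ℂ y (Metric.ball (γ t₁) δ) := fun z hz =>
      (hy z hz).differentiableAt.differentiableWithinAt
    refine ⟨y, hd.analyticAt (Metric.isOpen_ball.mem_nhds hb), ?_⟩
    filter_upwards [Ioo_mem_nhdsLT ht₁.2] with t ht
    exact eventuallyEq_along_of_solution hF hsol ht₁.2 Metric.isOpen_ball hy hγS hy1 ⟨ht.1.le, ht.2⟩
  · right
    rw [Filter.not_frequently] at hcase
    have hchart : ∀ᶠ t in 𝓝[<] (1 : unitInterval), ∃ ρ : ℂ, ρ ^ 3 = 1 ∧ (F t (γ t)).2 ≠ 0 ∧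
        ‖(F t (γ t)).2⁻¹‖ ≤ K ∧ ‖chartV α β ρ (γ t) (F t (γ t)).1 (F t (γ t)).2‖ ≤ K := by
      filter_upwards [hcase, self_mem_nhdsWithin] with t ht ht1
      exact hRK (γ t) _ _ (hZ t (Set.mem_univ _)) (hM t ht1) (not_lt.1 ht)
    -- there are only finitely many cube roots of unity, so one radius serves all three charts
    have hfin : Finite CubeRoot := by
      have : {x : ℂ | x ^ 3 = 1}.Finite := by
        refine ((Polynomial.nthRoots 3 (1 : ℂ)).toFinset.finite_toSet).subset fun x hx => ?_
        simpa [Polynomial.mem_nthRoots] using hx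
      exact this.to_subtype
    choose δ hδ hex using fun ρ : CubeRoot => exists_uniform_radius (contDiff_chartField α β ρ) Z K
    obtain ⟨ρ₀, hρ₀⟩ := Finite.exists_min δ
    obtain ⟨l, hl, hball⟩ := hev (δ ρ₀ / 2) (half_pos (hδ ρ₀))
    obtain ⟨t₁, ⟨ρ, hρ, hq, hu, hv⟩, ht₁⟩ := (hchart.and (Ioo_mem_nhdsLT hl)).exists
    obtain ⟨hb, hγS⟩ := hgeom (δ ⟨ρ, hρ⟩) l t₁
      (fun t ht => (hball t ht).trans_le (by linarith [hρ₀ ⟨ρ, hρ⟩])) ht₁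
    obtain ⟨U, hU1, hU⟩ := hex ⟨ρ, hρ⟩ (γ t₁) ((F t₁ (γ t₁)).2⁻¹,
      chartV α β ρ (γ t₁) (F t₁ (γ t₁)).1 (F t₁ (γ t₁)).2) (hZ t₁ (Set.mem_univ _))
      (max_le hu hv)
    refine ⟨⟨ρ, hρ⟩, U, Filter.eventually_of_mem (Metric.isOpen_ball.mem_nhds hb) hU, ?_⟩
    filter_upwards [Ioo_mem_nhdsLT ht₁.2] with t ht
    exact eventuallyEq_ofChart_along_of_solution hρ hF hsol ht₁.2 Metric.isOpen_ball hU hγS hq hU1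
      ⟨ht.1.le, ht.2⟩

end Endpoint

end CubicHamiltonian

end

theorem mainTheorem1 (α β z₀ zs : ℂ) (p q : ℂ → ℂ)
    (hsol : CubicHamiltonian.IsLocalSolution α β z₀ p q)
    (γ : Path z₀ zs) (hγ : BoundedVariationOn γ Set.univ)
    (F : unitInterval → ℂ → ℂ × ℂ)
    (hF : CubicHamiltonian.ContinuesAlong γ (Set.Iio 1) F)
    (hF₀ : F 0 =ᶠ[𝓝 z₀] fun z => (p z, q z))
    (hnot : ¬ ∃ G : unitInterval → ℂ → ℂ × ℂ,
      CubicHamiltonian.ContinuesAlong γ Set.univ G ∧ G 0 =ᶠ[𝓝 z₀] fun z => (p z, q z)) :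
    ∃ (ρ : CubicHamiltonian.CubeRoot) (U : ℂ → ℂ × ℂ) (c : ℂ)
      (P : (CubicHamiltonian.compactSurface α β zs).Carrier) (pHat qHat : ℂ → ℂ),
      -- the solution, written in the chart over `ρ`, is continued to `zs` by `U`
      AnalyticAt ℂ U zs ∧
      (∀ᶠ t in 𝓝[<] (1 : unitInterval), ∀ᶠ z in 𝓝 (γ t),
        CubicHamiltonian.point α β z (F t z) ∈ (CubicHamiltonian.finalChart α β z ρ).source ∧
        CubicHamiltonian.finalChart α β z ρ (CubicHamiltonian.point α β z (F t z)) = U z) ∧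
      -- at `zs` it reaches the point `P` with coordinates `(0, c)` on the third exceptional curve
      P ∈ CubicHamiltonian.initialSpace α β zs ∧
      P ∈ CubicHamiltonian.curveL₃ α β zs ρ ∧
      P ∉ (CubicHamiltonian.originalChart α β zs).source ∧
      P ∈ (CubicHamiltonian.finalChart α β zs ρ).source ∧
      CubicHamiltonian.finalChart α β zs ρ P = U zs ∧
      U zs = (0, c) ∧
      -- in the original variables the continued solution is a simple pole
      (∀ᶠ z in 𝓝[≠] zs, CubicHamiltonian.IsLocalSolution α β z pHat qHat) ∧
      (∀ᶠ z in 𝓝[≠] zs,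
        U z ∈ (CubicHamiltonian.finalChart α β z ρ).target ∧
        (CubicHamiltonian.finalChart α β z ρ).symm (U z) =
          CubicHamiltonian.point α β z (pHat z, qHat z)) ∧
      (∀ᶠ t in 𝓝[<] (1 : unitInterval), ∀ᶠ z in 𝓝 (γ t), F t z = (pHat z, qHat z)) ∧
      CubicHamiltonian.HasPoleExpansion α β zs ρ
        (c / 2 + (-α / 2 + 7 * ρ / 8 + β * (starRingEnd ℂ) (ρ : ℂ) / 2) * zs)
        (c * ρ / 2 - 3 * (starRingEnd ℂ) (ρ : ℂ) * zs / 8) pHat qHat := by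
  have h₀ : ∀ᶠ z in 𝓝 (γ 0), HasDerivAt (F 0)
      (CubicHamiltonian.systemField α β (z, F 0 z)) z := by
    rw [γ.source]
    filter_upwards [hF₀.eventuallyEq_nhds, hsol.2.2] with z hz hz'
    have h1 : HasDerivAt (fun z => (p z, q z))
        (CubicHamiltonian.systemField α β (z, (p z, q z))) z :=
      CubicHamiltonian.hasDerivAt_systemField_iff.2 hz'
    rw [hz.eq_of_nhds]
    exact h1.congr_of_eventuallyEq hz
  have hsolF := fun t (ht : t < 1) => CubicHamiltonian.solution_along hF h₀ ht
  have hreg : ¬ ∃ g, AnalyticAt ℂ g zs ∧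
      ∀ᶠ t in 𝓝[<] (1 : unitInterval), F t =ᶠ[𝓝 (γ t)] g := by
    rintro ⟨g, hg, hgF⟩
    refine hnot ⟨_, CubicHamiltonian.continuesAlong_of_eventuallyEq hF hg hgF, ?_⟩
    simpa using hF₀
  obtain ⟨ρ, U, hU, hFU⟩ :=
    (CubicHamiltonian.continues_or_exists_chart_solution hγ hF hsolF).resolve_left hreg
  have hUan : AnalyticAt ℂ U zs := by
    rw [Complex.analyticAt_iff_eventually_differentiableAt]
    exact hU.mono fun z hz => hz.differentiableAt
  have hU0 : (U zs).1 = 0 := by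
    by_contra hne
    exact hreg ⟨_, CubicHamiltonian.analyticAt_ofChart hUan hne,
      hFU.mono fun t ht => ht.mono fun z hz => hz.2⟩
  have hUzs : U zs = (0, (U zs).2) := Prod.ext hU0 rfl
  obtain ⟨hne, hexp⟩ := CubicHamiltonian.hasPoleExpansion_ofChart ρ hUan hU hUzs
  refine ⟨ρ, U, (U zs).2, CubicHamiltonian.polePoint α β zs ρ (U zs).2,
    fun z => (CubicHamiltonian.ofChart α β ρ z (U z)).1,
    fun z => (CubicHamiltonian.ofChart α β ρ z (U z)).2, hUan, ?_,
    CubicHamiltonian.polePoint_mem_initialSpace α β zs ρ _,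
    CubicHamiltonian.polePoint_mem_curveL₃ α β zs ρ _,
    CubicHamiltonian.polePoint_notMem_originalChart_source α β zs ρ _,
    CubicHamiltonian.polePoint_mem_finalChart_source α β zs ρ _,
    (CubicHamiltonian.finalChart_polePoint α β zs ρ _).trans hUzs.symm, hUzs, ?_, ?_, ?_, hexp⟩
  · filter_upwards [hFU] with t ht
    filter_upwards [ht] with z hz
    rw [hz.2]
    exact ⟨CubicHamiltonian.point_mem_finalChart_source α β z ρ (inv_ne_zero hz.1),
      CubicHamiltonian.finalChart_point_ofChart α β z ρ hz.1⟩
  · have hev := eventually_eventually_nhdsWithin.2 (hne.and (nhdsWithin_le_nhds hU))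
    filter_upwards [hev, self_mem_nhdsWithin, hne,
      nhdsWithin_le_nhds hUan.eventually_analyticAt] with z hz hzs hz0 hzan
    rw [isOpen_compl_singleton.nhdsWithin_eq hzs] at hz
    have han := CubicHamiltonian.analyticAt_ofChart (α := α) (β := β) (ρ := ρ) hzan hz0
    refine ⟨analyticAt_fst.comp han, analyticAt_snd.comp han, ?_⟩
    filter_upwards [hz] with w hw
    exact CubicHamiltonian.hasDerivAt_systemField_iff.1
      (CubicHamiltonian.hasDerivAt_ofChart ρ.2 hw.2 hw.1)
  · filter_upwards [hne] with z hz
    have hmem := CubicHamiltonian.point_mem_finalChart_source α β z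
      (p := (CubicHamiltonian.ofChart α β ρ z (U z)).1) ρ
      (q := (CubicHamiltonian.ofChart α β ρ z (U z)).2) (inv_ne_zero hz)
    have heq := CubicHamiltonian.finalChart_point_ofChart α β z ρ hz
    have h1 := (CubicHamiltonian.finalChart α β z ρ).map_source hmem
    have h2 := (CubicHamiltonian.finalChart α β z ρ).left_inv hmem
    rw [show ((CubicHamiltonian.ofChart α β ρ z (U z)).1,
      (CubicHamiltonian.ofChart α β ρ z (U z)).2) = CubicHamiltonian.ofChart α β ρ z (U z)
      from rfl] at h1 h2
    rw [heq] at h1 h2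
    exact ⟨h1, h2⟩
  · exact hFU.mono fun t ht => ht.mono fun z hz => hz.2
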